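/- Let $\mathfrak z$ be a Euclidean vector space with $\dim\mathfrak z=8$, and let $\mathfrak v\neq 0$ be a finite-dimensional orthogonal $\mathrm{Cl}(\mathfrak z)$-module: a real module over the Clifford algebra of $\mathfrak z$ with a scalar product such that $Z\bullet Z\bullet S=-\|Z\|^2S$ and $\langle Z\bullet S,\tilde S\rangle=-\langle S,Z\bullet\tilde S\rangle$ for $Z\in\mathfrak z$, $S,\tilde S\in\mathfrak v$. For $X=X_{\mathfrak z}\oplus X_{\mathfrak v}\in\mathfrak n:=\mathfrak z\oplus\mathfrak v$ let $\hat{\mathrm K}(X)\colon\mathfrak z\to\mathfrak z$ be the skew-symmetric operator given by $\langle\hat{\mathrm K}(X)Z_1,Z_2\rangle=\langle Z_1\bullet X_{\mathfrak z}\bullet X_{\mathfrak v},\,Z_2\bullet X_{\mathfrak v}\rangle$, and on $D=\{X\in\mathfrak n\mid X_{\mathfrak z}\ne0,\ X_{\mathfrak v}\neq0\}$ let $\check{\mathrm K}(X)=\hat{\mathrm K}(X)/(\|X_{\mathfrak z}\|\,\|X_{\mathfrak v}\|^2)$. Let $D\setminus\mathrm{ram}(\check{\mathrm K}^2)$ be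 the set of points of $D$ near which the number of distinct eigenvalues of $-\check{\mathrm K}^2$ (equivalently, the multiplicities of the eigenvalues) is constant. An eigenvalue branch on a connected component $U$ of this set is a real-analytic function $\check\mu\colon U\to\mathbb R$ such that $\check\mu(X)$ is an eigenvalue of $-\check{\mathrm K}(X)^2$ for all $X\in U$. A real number $\nu$ is a global eigenvalue of $-\check{\mathrm K}^2$ if $\nu\|X_{\mathfrak z}\|^2\|X_{\mathfrak v}\|^4$ is an eigenvalue of $-\hat{\mathrm K}(X)^2$ for all $X\in\mathfrak n$. (1) Suppose that $\mathfrak v$ is irreducible. Then $(\mathfrak z,\mathfrak v)$ can be identified, by isometries $\mathfrak z\cong\mathbb O$ and $\mathfrak v\cong\mathbb O\oplus\mathbb O$ that respect the Clifford multiplication, with the octonionic model $S_0\bullet(S_+\oplus S_-)=S_-S_0\oplus(-S_+S_0^*)$. On every connected component $U$ of $D\setminus\mathrm{ram}(\check{\mathrm K}^2)$ there is exactly one nonconstant eigenvalue branch $\check\mu$, and $\check\mu(X)$ has multiplicity $6$ for all $X\in U$. Under every such identification $X=S_0\oplus S_+\oplus S_-$ it is given by $$\|X_{\mathfrak z}\|^2\|X_{\mathfrak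 v}\|^4\,\check\mu(X)=\hat\mu(X)=4\bigl(\|S_0\|^2\|S_+\|^2\|S_-\|^2-\langle S_+,S_-S_0\rangle^2\bigr).$$ (2) Suppose that $\mathfrak v$ is reducible. Then on every connected component $U$ of $D\setminus\mathrm{ram}(\check{\mathrm K}^2)$ there are exactly three distinct nonconstant eigenvalue branches, and each of them has multiplicity $2$ at all points of $U$. (3) In neither case is $\nu=1$ a global eigenvalue of $-\check{\mathrm K}^2$. -/

import Mathlib

open scoped Quaternion InnerProductSpace Topology

set_option linter.unusedSectionVars false

noncomputable section

/-! ## Orthogonal Clifford modules -/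

/-- The negative definite quadratic form `Z ↦ -‖Z‖²` of a Euclidean vector space. -/
def negNormSq (z : Type*) [NormedAddCommGroup z] [InnerProductSpace ℝ z] : QuadraticForm ℝ z :=
  -LinearMap.BilinMap.toQuadraticMap (innerₗ z)

theorem negNormSq_apply {z : Type*} [NormedAddCommGroup z] [InnerProductSpace ℝ z] (Z : z) :
    negNormSq z Z = -‖Z‖ ^ 2 := by
  simp [negNormSq, LinearMap.BilinMap.toQuadraticMap_apply]

/-- The Clifford algebra of a Euclidean vector space, in the convention `Z * Z = -‖Z‖²`. -/
abbrev Cl (z : Type*) [NormedAddCommGroup z] [InnerProductSpace ℝ z] : Type _ :=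
  CliffordAlgebra (negNormSq z)

section

variable {z v : Type*} [NormedAddCommGroup z] [InnerProductSpace ℝ z]
  [NormedAddCommGroup v] [InnerProductSpace ℝ v] [Module (Cl z) v] [IsScalarTower ℝ (Cl z) v]

/-- Clifford multiplication `Z • S` of a spinor by a vector. -/
def cmul (Z : z) (S : v) : v := CliffordAlgebra.ι (negNormSq z) Z • S

theorem cmul_add_left (Z W : z) (S : v) : cmul (Z + W) S = cmul Z S + cmul W S := by
  simp [cmul, add_smul]

theorem cmul_smul_left (c : ℝ) (Z : z) (S : v) : cmul (c • Z) S = c • cmul Z S := by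
  simp [cmul]

theorem cmul_cmul (Z : z) (S : v) : cmul Z (cmul Z S) = -(‖Z‖ ^ 2 • S) := by
  rw [cmul, cmul, smul_smul, CliffordAlgebra.ι_sq_scalar, negNormSq_apply, algebraMap_smul,
    neg_smul]

/-- The linear map `Z ↦ Z • S` from vectors to spinors. -/
def cmulRight (S : v) : z →ₗ[ℝ] v where
  toFun Z := cmul Z S
  map_add' Z W := cmul_add_left Z W S
  map_smul' c Z := cmul_smul_left c Z S

variable (z v) in
/-- The scalar product of the `Cl(z)`-module `v` makes it an orthogonal Clifford module: Clifford
multiplication by vectors is skew-symmetric. (The relation `Z • Z • S = -‖Z‖² S` holds in every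
`Cl(z)`-module.) -/
def IsOrthogonalCliffordModule : Prop :=
  ∀ (Z : z) (S T : v), ⟪cmul Z S, T⟫_ℝ = -⟪S, cmul Z T⟫_ℝ

/-! ## The operators `K̂(X)` and `Ǩ(X)`, for `X = (X_z, X_v)` in `𝔫 = z ⊕ v`

Only the topology and the analytic structure of the vector space `𝔫` are used below, hence it is
written as the product type `z × v`. -/

variable [FiniteDimensional ℝ z] [FiniteDimensional ℝ v]

/-- The operator `K̂(X)` on `z`, determined by `⟪K̂(X) Z₁, Z₂⟫ = ⟪Z₁ • X_z • X_v, Z₂ • X_v⟫`. -/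
def hatK (X : z × v) : Module.End ℝ z :=
  LinearMap.adjoint (cmulRight (z := z) X.2) ∘ₗ cmulRight (cmul X.1 X.2)

theorem inner_hatK (X : z × v) (Z₁ Z₂ : z) :
    ⟪hatK X Z₁, Z₂⟫_ℝ = ⟪cmul Z₁ (cmul X.1 X.2), cmul Z₂ X.2⟫_ℝ := by
  simp [hatK, LinearMap.adjoint_inner_left, cmulRight]

/-- The rescaled operator `Ǩ(X) = K̂(X) / (‖X_z‖ ‖X_v‖²)`, meant for `X_z ≠ 0` and `X_v ≠ 0`. -/
def checkK (X : z × v) : Module.End ℝ z := (‖X.1‖ * ‖X.2‖ ^ 2)⁻¹ • hatK X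

/-- The nonnegative self-adjoint operator `-K̂(X)²`. -/
def negHatKSq (X : z × v) : Module.End ℝ z := -(hatK X * hatK X)

/-- The nonnegative self-adjoint operator `-Ǩ(X)²`. -/
def negCheckKSq (X : z × v) : Module.End ℝ z := -(checkK X * checkK X)

/-! ## Eigenvalue branches of `-Ǩ²` -/

/-- The number of distinct eigenvalues of `-Ǩ(X)²`. -/
def numEigenvalues (X : z × v) : ℕ := {ν : ℝ | (negCheckKSq X).HasEigenvalue ν}.ncard

/-- The multiplicity of `ν` as an eigenvalue of (the self-adjoint operator) `-Ǩ(X)²`. -/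
def eigMult (X : z × v) (ν : ℝ) : ℕ := Module.finrank ℝ ((negCheckKSq X).eigenspace ν)

variable (z v) in
/-- The complement of the ramification locus of `Ǩ²` in `D = {X | X_z ≠ 0, X_v ≠ 0}`: the points
of `D` near which the number of distinct eigenvalues of `-Ǩ²` is constant. Since the operators
are self-adjoint and depend continuously on `X`, this means that no eigenvalues split or collide
near `X`, i.e. that the multiplicities of the eigenvalues are constant near `X`. -/
def unramified : Set (z × v) :=
  {X | X.1 ≠ 0 ∧ X.2 ≠ 0 ∧ ∀ᶠ Y in 𝓝 X, numEigenvalues Y = numEigenvalues X}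

variable (z v) in
/-- `U` is a connected component of the complement of the ramification locus of `Ǩ²`. -/
def IsUnramifiedComponent (U : Set (z × v)) : Prop :=
  ∃ X ∈ unramified z v, U = connectedComponentIn (unramified z v) X

/-- The eigenvalue branches of `-Ǩ²` on `U`: real-analytic functions `μ : U → ℝ` such that `μ X`
is an eigenvalue of `-Ǩ(X)²` for all `X ∈ U`. -/
def eigenvalueBranches (U : Set (z × v)) : Set (U → ℝ) :=
  {μ | (∃ f : z × v → ℝ, AnalyticOnNhd ℝ f U ∧ ∀ X : U, f X = μ X) ∧
    ∀ X : U, (negCheckKSq (X : z × v)).HasEigenvalue (μ X)}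

/-- The nonconstant eigenvalue branches of `-Ǩ²` on `U`. -/
def nonconstantBranches (U : Set (z × v)) : Set (U → ℝ) :=
  {μ ∈ eigenvalueBranches U | ¬ ∃ c : ℝ, ∀ X : U, μ X = c}

variable (z v) in
/-- `ν` is a global eigenvalue of `-Ǩ²`: the number `ν ‖X_z‖² ‖X_v‖⁴` is an eigenvalue of
`-K̂(X)²` for every `X`. -/
def IsGlobalEigenvalue (ν : ℝ) : Prop :=
  ∀ X : z × v, (negHatKSq X).HasEigenvalue (ν * ‖X.1‖ ^ 2 * ‖X.2‖ ^ 4)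

end

/-! ## The octonionic model -/

/-- The Euclidean space of octonions `𝕆 = ℍ ⊕ ℍ`. -/
abbrev Octonion : Type := WithLp 2 (ℍ[ℝ] × ℍ[ℝ])

/-- The product of octonions, `(a, b)(c, d) = (ac - d* b, da + bc*)` (Cayley-Dickson). -/
def Octonion.mul (x y : Octonion) : Octonion :=
  WithLp.toLp 2 (x.fst * y.fst - star y.snd * x.snd, y.snd * x.fst + x.snd * star y.fst)

/-- Octonionic conjugation, `(a, b)* = (a*, -b)`. -/
def Octonion.conj (x : Octonion) : Octonion := WithLp.toLp 2 (star x.fst, -x.snd)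

/-- The Euclidean space `𝕆 ⊕ 𝕆`, with elements `S₊ ⊕ S₋`. -/
abbrev OctonionSq : Type := WithLp 2 (Octonion × Octonion)

/-- The model of Clifford multiplication of `𝕆` on `𝕆 ⊕ 𝕆`:
`S₀ • (S₊ ⊕ S₋) = S₋ S₀ ⊕ (-S₊ S₀*)`. -/
def octCmul (S₀ : Octonion) (S : OctonionSq) : OctonionSq :=
  WithLp.toLp 2 (Octonion.mul S.snd S₀, -Octonion.mul S.fst (Octonion.conj S₀))

/-- The polynomial `μ̂(S₀ ⊕ S₊ ⊕ S₋) = 4 (‖S₀‖² ‖S₊‖² ‖S₋‖² - ⟪S₊, S₋ S₀⟫²)`. -/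
def octHatMu (S₀ : Octonion) (S : OctonionSq) : ℝ :=
  4 * (‖S₀‖ ^ 2 * ‖S.fst‖ ^ 2 * ‖S.snd‖ ^ 2 - ⟪S.fst, Octonion.mul S.snd S₀⟫_ℝ ^ 2)

/-- An isometric identification of the pair `(z, v)`, with its Clifford multiplication, with the
octonionic model `(𝕆, 𝕆 ⊕ 𝕆)`. -/
structure OctonionicModel (z v : Type*) [NormedAddCommGroup z] [InnerProductSpace ℝ z]
    [NormedAddCommGroup v] [InnerProductSpace ℝ v] [Module (Cl z) v] where
  onVectors : z ≃ₗᵢ[ℝ] Octonion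
  onSpinors : v ≃ₗᵢ[ℝ] OctonionSq
  map_cmul : ∀ (Z : z) (S : v), onSpinors (cmul Z S) = octCmul (onVectors Z) (onSpinors S)

end

/-! The operator `hatK X` is skew and kills `X.1`. Hence `negHatKSq X` is symmetric and always has
the eigenvalue 0. Its eigenspaces for nonzero eigenvalues are even-dimensional, since `hatK X`
squares to a negative scalar there; as `z` has dimension 8, the kernel is even-dimensional too. So
there are at most four distinct eigenvalues.

For an analytic family of symmetric operators the number of distinct eigenvalues is lower
semicontinuous, and the points with at least as many as some given point form a dense set. If `n`
bounds this number on `D` and is reached somewhere, the unramified points are exactly the points of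
`D` with `n` eigenvalues (`unramified_eq`). There the sorted eigenvalues are analytic
(`analyticAt_sortedEigenvalue`), and on a connected component they are the only branches. A branch
with constant value `c` makes a determinant vanish on an open set, hence everywhere by analyticity.
But `hatK` vanishes at a point of `D`, so `c = 0` (`eq_zero_of_hasEigenvalue_on_open`). This leaves
`n - 1` nonconstant branches, and the same point shows that 1 is not a global eigenvalue.

It remains to find `n`. Each nonzero submodule contains a spinor fixed by four commuting involutions
of the Clifford algebra; products of vectors act on it by the octonionic multiplication table
(`exists_isOctonionicSpinor`), so it generates a copy of the octonionic model. An irreducible module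
is one such copy. There `X.2` is either a half-spinor, where `hatK X = 0`, or `s + T • s` with a
half-spinor `s`. In the latter case `negHatKSq X` is the scalar `octHatMu` on the vectors
perpendicular to `X.1` and `T` (`OctonionicModel.negHatKSq_spectrum`), so `n = 2`. A reducible
module contains two orthogonal copies, on whose sum `hatK` is additive, and an explicit point has
the eigenvalues 0, 4, 20, 36, so `n = 4`. -/

noncomputable section

/-! ### Distinct eigenvalues in analytic families of symmetric operators. -/

section Spectral

open Module.End Polynomial ContDiff

variable {V : Type*} [NormedAddCommGroup V] [InnerProductSpace ℝ V] [FiniteDimensional ℝ V]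

/-- The finite set of eigenvalues of an endomorphism. -/
def eigenvalueFinset (T : Module.End ℝ V) : Finset ℝ := (Module.End.finite_hasEigenvalue T).toFinset

@[simp]
theorem mem_eigenvalueFinset {T : Module.End ℝ V} {ν : ℝ} :
    ν ∈ eigenvalueFinset T ↔ T.HasEigenvalue ν := by
  simp [eigenvalueFinset]

theorem ncard_hasEigenvalue (T : Module.End ℝ V) :
    {ν : ℝ | T.HasEigenvalue ν}.ncard = (eigenvalueFinset T).card :=
  Set.ncard_eq_toFinset_card _ _

/-- The monic polynomial whose roots are the eigenvalues of `T`, all of them simple. -/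
def eigenvaluePolynomial (T : Module.End ℝ V) : ℝ[X] := ∏ ν ∈ eigenvalueFinset T, (X - C ν)

/-- A symmetric operator has an eigenbasis, so simple roots suffice to annihilate it. -/
theorem aeval_eigenvaluePolynomial {T : Module.End ℝ V} (hT : T.IsSymmetric) :
    aeval T (eigenvaluePolynomial T) = 0 := by
  refine (hT.eigenvectorBasis rfl).toBasis.ext fun i => ?_
  have h := hT.hasEigenvector_eigenvectorBasis rfl i
  rw [OrthonormalBasis.coe_toBasis, aeval_apply_of_hasEigenvector h, eigenvaluePolynomial,
    eval_prod, Finset.prod_eq_zero (i := (hT.eigenvalues rfl i : ℝ)), zero_smul,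
    LinearMap.zero_apply]
  · rw [mem_eigenvalueFinset]; exact hasEigenvalue_of_hasEigenvector h
  · simp

theorem monic_eigenvaluePolynomial (T : Module.End ℝ V) : (eigenvaluePolynomial T).Monic :=
  monic_prod_of_monic _ _ fun _ _ => monic_X_sub_C _

theorem natDegree_eigenvaluePolynomial (T : Module.End ℝ V) :
    (eigenvaluePolynomial T).natDegree = (eigenvalueFinset T).card := by
  rw [eigenvaluePolynomial, natDegree_prod_of_monic _ (fun ν => X - C ν) fun ν _ => monic_X_sub_C ν]
  simp

theorem isRoot_of_aeval_eq_zero {T : Module.End ℝ V} {p : ℝ[X]} (hp : aeval T p = 0)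
    {ν : ℝ} (hν : T.HasEigenvalue ν) : p.IsRoot ν := by
  obtain ⟨x, hx⟩ := hν.exists_hasEigenvector
  have := aeval_apply_of_hasEigenvector (p := p) hx
  rw [hp, LinearMap.zero_apply] at this
  exact (smul_eq_zero.mp this.symm).resolve_right hx.2

/-- The annihilating polynomial is a monic relation among the powers of `T`. With the next lemma,
counting eigenvalues becomes independence of powers, which is an open condition expressible by
determinants. -/
theorem le_card_eigenvalueFinset {T : Module.End ℝ V} (hT : T.IsSymmetric) {k : ℕ}
    (h : LinearIndependent ℝ fun i : Fin k => T ^ (i : ℕ)) : k ≤ (eigenvalueFinset T).card := by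
  by_contra! hlt
  have h0 := aeval_eigenvaluePolynomial hT
  rw [aeval_eq_sum_range' (n := k) (by rwa [natDegree_eigenvaluePolynomial]),
    ← Fin.sum_univ_eq_sum_range (fun i => (eigenvaluePolynomial T).coeff i • T ^ i)] at h0
  have := Fintype.linearIndependent_iff.mp h _ h0 ⟨_, hlt⟩
  have h1 := (monic_eigenvaluePolynomial T).coeff_natDegree
  rw [natDegree_eigenvaluePolynomial] at h1
  exact one_ne_zero (h1.symm.trans this)

theorem linearIndependent_pow_of_le_card (T : Module.End ℝ V) {k : ℕ}
    (h : k ≤ (eigenvalueFinset T).card) :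
    LinearIndependent ℝ fun i : Fin k => T ^ (i : ℕ) := by
  rw [Fintype.linearIndependent_iff]
  intro g hg
  let p : ℝ[X] := ∑ i : Fin k, C (g i) * X ^ (i : ℕ)
  have hp : aeval T p = 0 := by
    simp only [p, map_sum, map_mul, aeval_C, map_pow, aeval_X]
    simpa [Algebra.smul_def] using hg
  have hdeg : p.degree < k := by
    refine (degree_sum_le _ _).trans_lt ?_
    rw [Finset.sup_lt_iff (by exact WithBot.bot_lt_coe k)]
    intro i _
    exact (degree_C_mul_X_pow_le _ _).trans_lt (by exact_mod_cast i.2)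
  have h0 : p = 0 := eq_zero_of_degree_lt_of_eval_finset_eq_zero (eigenvalueFinset T)
    (hdeg.trans_le (by exact_mod_cast h)) fun ν hν =>
      isRoot_of_aeval_eq_zero hp (mem_eigenvalueFinset.mp hν)
  intro i
  have := congrArg (fun q => q.coeff (i : ℕ)) h0
  simpa [p, finsetSum_coeff, coeff_C_mul, coeff_X_pow, Fin.ext_iff, Finset.sum_ite_eq,
    ← Fin.ext_iff] using this

theorem eval_eigenvaluePolynomial_eq_zero_iff (T : Module.End ℝ V) (ν : ℝ) :
    (eigenvaluePolynomial T).eval ν = 0 ↔ T.HasEigenvalue ν := by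
  rw [eigenvaluePolynomial, eval_prod, Finset.prod_eq_zero_iff]
  simp [sub_eq_zero]

theorem eval_derivative_eigenvaluePolynomial_ne_zero {T : Module.End ℝ V} {ν : ℝ}
    (hν : T.HasEigenvalue ν) : (derivative (eigenvaluePolynomial T)).eval ν ≠ 0 := by
  have hs : (eigenvaluePolynomial T).Separable := by
    rw [eigenvaluePolynomial]
    exact separable_prod_X_sub_C_iff'.mpr fun _ _ _ _ h => h
  exact hs.eval₂_derivative_ne_zero (RingHom.id ℝ)
    (by simpa [eval₂_id] using (eval_eigenvaluePolynomial_eq_zero_iff T ν).mpr hν)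

section Family

variable {E : Type*} [NormedAddCommGroup E] [NormedSpace ℝ E]
variable {F : E → V →L[ℝ] V}

theorem linearIndependent_clm_pow_iff (A : V →L[ℝ] V) (k : ℕ) :
    (LinearIndependent ℝ fun i : Fin k => A ^ (i : ℕ)) ↔
      LinearIndependent ℝ fun i : Fin k => (A : V →ₗ[ℝ] V) ^ (i : ℕ) := by
  rw [← LinearMap.linearIndependent_iff (ContinuousLinearMap.coeLM ℝ (M := V) (N₃ := V))
    (LinearMap.ker_eq_bot.mpr ContinuousLinearMap.coe_injective)]
  have : (⇑(ContinuousLinearMap.coeLM ℝ (M := V) (N₃ := V)) ∘ fun i : Fin k => A ^ (i : ℕ)) =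
      fun i : Fin k => (A : V →ₗ[ℝ] V) ^ (i : ℕ) := by
    funext i
    exact ContinuousLinearMap.toLinearMap_pow A i
  rw [this]

theorem eventually_card_eigenvalueFinset_le {X : E} (hF : ContinuousAt F X)
    (hsym : ∀ᶠ Y in 𝓝 X, (F Y : V →ₗ[ℝ] V).IsSymmetric) :
    ∀ᶠ Y in 𝓝 X, (eigenvalueFinset (F X : V →ₗ[ℝ] V)).card ≤
      (eigenvalueFinset (F Y : V →ₗ[ℝ] V)).card := by
  set k := (eigenvalueFinset (F X : V →ₗ[ℝ] V)).card
  have h1 : LinearIndependent ℝ fun i : Fin k => F X ^ (i : ℕ) :=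
    (linearIndependent_clm_pow_iff _ _).mpr (linearIndependent_pow_of_le_card _ le_rfl)
  have h2 : ContinuousAt (fun Y => fun i : Fin k => F Y ^ (i : ℕ)) X :=
    continuousAt_pi.mpr fun i => hF.pow _
  filter_upwards [h2.eventually (isOpen_setOfPred_linearIndependent.mem_nhds h1), hsym] with Y hY hs
  exact le_card_eigenvalueFinset hs ((linearIndependent_clm_pow_iff _ _).mp hY)

theorem dense_le_card_eigenvalueFinset (hF : ContDiff ℝ ω F)
    (hsym : ∀ Y, (F Y : V →ₗ[ℝ] V).IsSymmetric) {X : E} {k : ℕ}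
    (hX : k ≤ (eigenvalueFinset (F X : V →ₗ[ℝ] V)).card) :
    Dense {Y | k ≤ (eigenvalueFinset (F Y : V →ₗ[ℝ] V)).card} := by
  have h1 : LinearIndependent ℝ fun i : Fin k => F X ^ (i : ℕ) :=
    (linearIndependent_clm_pow_iff _ _).mpr (linearIndependent_pow_of_le_card _ hX)
  obtain ⟨L, hL⟩ := LinearMap.exists_leftInverse_of_injective
    (Fintype.linearCombination ℝ fun i : Fin k => F X ^ (i : ℕ))
    (LinearMap.ker_eq_bot.mpr (linearIndependent_iff_injective_fintypeLinearCombination.mp h1))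
  have hLX (i : Fin k) : L (F X ^ (i : ℕ)) = Pi.single i 1 := by
    have := congrArg (fun f => f (Pi.single i 1)) hL
    simpa [Fintype.linearCombination_apply_single] using this
  -- `L` is a left inverse at `X`, so this matrix is the identity there. Its determinant is analytic
  -- in `Y`, and where it is nonzero the powers of `F Y` are independent.
  let M : E → Matrix (Fin k) (Fin k) ℝ := fun Y => Matrix.of fun j i => L (F Y ^ (j : ℕ)) i
  have hMX : (M X).det ≠ 0 := by
    have : M X = 1 := by
      ext j i
      simp only [M, Matrix.of_apply, hLX, Matrix.one_apply, Pi.single_apply, eq_comm]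
    simp [this]
  have hind (Y : E) (h : (M Y).det ≠ 0) : k ≤ (eigenvalueFinset (F Y : V →ₗ[ℝ] V)).card := by
    refine le_card_eigenvalueFinset (hsym Y) ((linearIndependent_clm_pow_iff _ _).mp ?_)
    exact LinearIndependent.of_comp L
      (Matrix.linearIndependent_rows_of_det_ne_zero h)
  have hentry (i j : Fin k) : ContDiff ℝ ω fun Y => L (F Y ^ (j : ℕ)) i := by
    have : ContDiff ℝ ω fun Y => (LinearMap.toContinuousLinearMap L) (F Y ^ (j : ℕ)) :=
      (ContinuousLinearMap.contDiff _).comp (hF.pow _)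
    exact contDiff_pi.mp this i
  have hdet : ContDiff ℝ ω fun Y => (M Y).det := by
    simp only [Matrix.det_apply]
    refine ContDiff.sum fun σ _ => ContDiff.const_smul _ (contDiff_prod fun i _ => hentry _ _)
  have han : AnalyticOnNhd ℝ (fun Y => (M Y).det) Set.univ := fun Y _ =>
    (hdet.contDiffAt).analyticAt
  rw [dense_iff_closure_eq, Set.eq_univ_iff_forall]
  intro Y
  by_contra hY
  have hz : (fun Y => (M Y).det) =ᶠ[𝓝 Y] 0 := by
    rw [mem_closure_iff_frequently, Filter.not_frequently] at hY
    filter_upwards [hY] with W hW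
    by_contra h
    exact hW (hind W h)
  have := han.eqOn_zero_of_preconnected_of_eventuallyEq_zero isPreconnected_univ
    (Set.mem_univ Y) hz (Set.mem_univ X)
  exact hMX this

/-- If the number of distinct eigenvalues of an analytic family of symmetric operators has a local
maximum at `X`, then each eigenvalue at `X` extends to an analytic family of eigenvalues near `X`. -/
theorem exists_analyticAt_hasEigenvalue [CompleteSpace E] {X : E} (hF : ContDiffAt ℝ ω F X)
    (hsym : ∀ᶠ Y in 𝓝 X, (F Y : V →ₗ[ℝ] V).IsSymmetric)
    (hle : ∀ᶠ Y in 𝓝 X, (eigenvalueFinset (F Y : V →ₗ[ℝ] V)).card ≤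
      (eigenvalueFinset (F X : V →ₗ[ℝ] V)).card)
    {ν : ℝ} (hν : Module.End.HasEigenvalue (F X : V →ₗ[ℝ] V) ν) :
    ∃ g : E → ℝ, AnalyticAt ℝ g X ∧ g X = ν ∧
      ∀ᶠ Y in 𝓝 X, Module.End.HasEigenvalue (F Y : V →ₗ[ℝ] V) (g Y) := by
  set k := (eigenvalueFinset (F X : V →ₗ[ℝ] V)).card with hk
  have h1 : LinearIndependent ℝ fun i : Fin k => F X ^ (i : ℕ) :=
    (linearIndependent_clm_pow_iff _ _).mpr (linearIndependent_pow_of_le_card _ le_rfl)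
  obtain ⟨L₀, hL₀⟩ := LinearMap.exists_leftInverse_of_injective
    (Fintype.linearCombination ℝ fun i : Fin k => F X ^ (i : ℕ))
    (LinearMap.ker_eq_bot.mpr (linearIndependent_iff_injective_fintypeLinearCombination.mp h1))
  let L : (V →L[ℝ] V) →L[ℝ] (Fin k → ℝ) := LinearMap.toContinuousLinearMap L₀
  -- Sends coefficients `c` to the coordinates of `∑ c j • F Y ^ j` under `L`. It is the identity at
  -- `X`, hence invertible nearby.
  let N : E → (Fin k → ℝ) →L[ℝ] (Fin k → ℝ) := fun Y =>
    ∑ j : Fin k, (ContinuousLinearMap.proj j : (Fin k → ℝ) →L[ℝ] ℝ).smulRight (L (F Y ^ (j : ℕ)))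
  have hN (Y : E) (c : Fin k → ℝ) : N Y c = L (∑ j, c j • F Y ^ (j : ℕ)) := by
    simp [N]
  have hNX : N X = 1 := by
    ext1 c
    rw [hN]
    have := congrArg (fun f => f c) hL₀
    simpa [L, Fintype.linearCombination_apply] using this
  have hNc : ContDiffAt ℝ ω N X := by
    refine ContDiffAt.sum fun j _ => ?_
    have h2 : ContDiffAt ℝ ω (fun Y => L (F Y ^ (j : ℕ))) X :=
      L.contDiff.contDiffAt.comp X (hF.pow _)
    exact (ContinuousLinearMap.smulRightL ℝ (Fin k → ℝ) (Fin k → ℝ)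
      (ContinuousLinearMap.proj j)).contDiff.contDiffAt.comp X h2
  have hunit : ∀ᶠ Y in 𝓝 X, IsUnit (N Y) :=
    hNc.continuousAt.eventually (Units.isOpen.mem_nhds (by rw [hNX]; exact isUnit_one))
  -- Near `X` there are exactly `k` eigenvalues, so `F Y ^ k` is a combination of lower powers.
  -- Solving for its coefficients shows that the eigenvalue polynomial depends analytically on `Y`.
  let a : E → Fin k → ℝ := fun Y => Ring.inverse (N Y) (L (F Y ^ k))
  have ha : ContDiffAt ℝ ω a X := by
    have h2 : ContDiffAt ℝ ω (fun Y => Ring.inverse (N Y)) X := by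
      have := contDiffAt_ringInverse ℝ (n := ω) (1 : ((Fin k → ℝ) →L[ℝ] (Fin k → ℝ))ˣ)
      rw [Units.val_one, ← hNX] at this
      exact this.comp X hNc
    exact h2.clm_apply (L.contDiff.contDiffAt.comp X (hF.pow _))
  let p : E → ℝ[X] := fun Y => Polynomial.X ^ k - ∑ j : Fin k, C (a Y j) * Polynomial.X ^ (j : ℕ)
  have hp : ∀ᶠ Y in 𝓝 X, p Y = eigenvaluePolynomial (F Y : V →ₗ[ℝ] V) := by
    filter_upwards [hunit, hsym, hle,
      eventually_card_eigenvalueFinset_le hF.continuousAt hsym] with Y hu hs h₁ h₂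
    set q := eigenvaluePolynomial (F Y : V →ₗ[ℝ] V) with hq
    have hcard : (eigenvalueFinset (F Y : V →ₗ[ℝ] V)).card = k := le_antisymm h₁ h₂
    have hqd : q.natDegree = k := by rw [hq, natDegree_eigenvaluePolynomial, hcard]
    have hq0 : aeval (F Y) q = 0 := by
      refine ContinuousLinearMap.coe_injective ?_
      have h3 := aeval_eigenvaluePolynomial hs
      have h4 := map_aeval_eq_aeval_map
        (show (algebraMap ℝ (V →ₗ[ℝ] V)).comp (RingHom.id ℝ) =
          (ContinuousLinearMap.toLinearMapRingHom (R₁ := ℝ) (M₁ := V)).comp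
            (algebraMap ℝ (V →L[ℝ] V)) from rfl) q (F Y)
      rw [Polynomial.map_id] at h4
      exact h4.trans h3
    have hsum : F Y ^ k = ∑ j : Fin k, (-q.coeff j) • F Y ^ (j : ℕ) := by
      rw [aeval_eq_sum_range, hqd, Finset.sum_range_succ, ← hqd,
        (monic_eigenvaluePolynomial (F Y : V →ₗ[ℝ] V)).coeff_natDegree, one_smul, hqd,
        ← Fin.sum_univ_eq_sum_range (fun i => q.coeff i • F Y ^ i)] at hq0
      simp only [neg_smul, Finset.sum_neg_distrib]
      exact eq_neg_of_add_eq_zero_right hq0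
    have haY : a Y = fun j : Fin k => -q.coeff j := by
      simp only [a]
      rw [hsum, ← hN Y fun j => -q.coeff j, ← mul_apply_eq_comp,
        Ring.inverse_mul_cancel _ hu, one_apply_eq_self]
    simp only [p, haY]
    have h5 := (show q.Monic from monic_eigenvaluePolynomial _).as_sum
    rw [hqd, ← Fin.sum_univ_eq_sum_range (fun i => C (q.coeff i) * Polynomial.X ^ i)] at h5
    refine Eq.trans ?_ h5.symm
    simp
  let f : E × ℝ → ℝ := fun u => u.2 ^ k - ∑ j : Fin k, a u.1 j * u.2 ^ (j : ℕ)
  have hf (u : E × ℝ) : f u = (p u.1).eval u.2 := by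
    simp [f, p, eval_finsetSum]
  have hfc : ContDiffAt ℝ ω f (X, ν) := by
    refine (contDiffAt_snd.pow k).sub (ContDiffAt.sum fun j _ => ContDiffAt.mul ?_
      (contDiffAt_snd.pow _))
    exact (contDiffAt_pi.mp ha j).comp (X, ν) contDiffAt_fst
  -- The roots of the eigenvalue polynomial are simple, so the implicit function theorem applies.
  have hinv : (fderiv ℝ f (X, ν) ∘L .inr ℝ E ℝ).IsInvertible := by
    have h2 : HasFDerivAt (fun t : ℝ => f (X, t)) (fderiv ℝ f (X, ν) ∘L .inr ℝ E ℝ) ν :=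
      HasFDerivAt.comp ν (hfc.differentiableAt (by simp)).hasFDerivAt
        (hasFDerivAt_prodMk_right X ν)
    have h3 : HasDerivAt (fun t : ℝ => f (X, t)) ((derivative (p X)).eval ν) ν := by
      simp only [hf]
      exact (p X).hasDerivAt ν
    have h4 := h2.unique h3.hasFDerivAt
    rw [h4, hp.self_of_nhds]
    have h5 := eval_derivative_eigenvaluePolynomial_ne_zero hν
    exact ⟨ContinuousLinearEquiv.unitsEquivAut ℝ (Units.mk0 _ h5), by ext; simp⟩
  have h0 : f (X, ν) = 0 := by
    rw [hf, hp.self_of_nhds]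
    exact (eval_eigenvaluePolynomial_eq_zero_iff _ _).mpr hν
  refine ⟨hfc.implicitFunction (by simp) hinv,
    (hfc.contDiffAt_implicitFunction (by simp) hinv).analyticAt,
    hfc.implicitFunction_apply_self (by simp) hinv, ?_⟩
  filter_upwards [hfc.eventually_apply_implicitFunction (by simp) hinv, hp] with Y hY hpY
  rw [h0, hf, hpY, eval_eigenvaluePolynomial_eq_zero_iff] at hY
  exact hY

end Family

end Spectral

/-! ### Eigenvalues under rescaling. -/

section SmulEigen

variable {V : Type*} [NormedAddCommGroup V] [InnerProductSpace ℝ V] [FiniteDimensional ℝ V]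

theorem eigenspace_smul_mul (T : Module.End ℝ V) {c : ℝ} (hc : c ≠ 0) (ν : ℝ) :
    (c • T).eigenspace (c * ν) = T.eigenspace ν := by
  ext x
  rw [Module.End.mem_eigenspace_iff, Module.End.mem_eigenspace_iff, LinearMap.smul_apply, mul_smul]
  exact (smul_right_injective V hc).eq_iff

theorem hasEigenvalue_smul_mul (T : Module.End ℝ V) {c : ℝ} (hc : c ≠ 0) (ν : ℝ) :
    (c • T).HasEigenvalue (c * ν) ↔ T.HasEigenvalue ν := by
  rw [Module.End.hasEigenvalue_iff, Module.End.hasEigenvalue_iff, eigenspace_smul_mul T hc]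

theorem card_eigenvalueFinset_smul (T : Module.End ℝ V) {c : ℝ} (hc : c ≠ 0) :
    (eigenvalueFinset (c • T)).card = (eigenvalueFinset T).card := by
  symm
  refine Finset.card_bij (fun ν _ => c * ν) (fun ν hν => ?_) (fun a _ b _ h => ?_) fun ν hν => ?_
  · rw [mem_eigenvalueFinset] at hν ⊢
    exact (hasEigenvalue_smul_mul T hc ν).mpr hν
  · exact mul_left_cancel₀ hc h
  · refine ⟨c⁻¹ * ν, ?_, by field_simp⟩
    rw [mem_eigenvalueFinset] at hν ⊢
    rw [← hasEigenvalue_smul_mul T hc, mul_inv_cancel_left₀ hc]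
    exact hν

end SmulEigen

/-! ### Clifford identities, and analyticity of the operators `hatK`. -/

section Clifford

open ContDiff

variable {z v : Type*} [NormedAddCommGroup z] [InnerProductSpace ℝ z]
  [NormedAddCommGroup v] [InnerProductSpace ℝ v] [Module (Cl z) v] [IsScalarTower ℝ (Cl z) v]

theorem cmul_add_right (Z : z) (S T : v) : cmul Z (S + T) = cmul Z S + cmul Z T := smul_add _ _ _

theorem cmul_smul_right (c : ℝ) (Z : z) (S : v) : cmul Z (c • S) = c • cmul Z S :=
  smul_comm _ _ _

theorem cmul_neg_right (Z : z) (S : v) : cmul Z (-S) = -cmul Z S := smul_neg _ _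

theorem cmul_sub_right (Z : z) (S T : v) : cmul Z (S - T) = cmul Z S - cmul Z T := smul_sub _ _ _

theorem cmul_zero_right (Z : z) : cmul Z (0 : v) = 0 := smul_zero _

theorem cmul_neg_left (Z : z) (S : v) : cmul (-Z) S = -cmul Z S := by simp [cmul]

/-- The Clifford relation `Z • W + W • Z = -2 ⟪Z, W⟫`. -/
theorem cmul_cmul_add (Z W : z) (S : v) :
    cmul Z (cmul W S) + cmul W (cmul Z S) = -((2 * ⟪Z, W⟫_ℝ) • S) := by
  have h := cmul_cmul (Z + W) S
  simp only [cmul_add_left, cmul_add_right, cmul_cmul, norm_add_sq_real] at h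
  have h2 : cmul Z (cmul W S) + cmul W (cmul Z S) =
      -(‖Z‖ ^ 2 • S) + cmul W (cmul Z S) + (cmul Z (cmul W S) + -(‖W‖ ^ 2 • S)) +
        (‖Z‖ ^ 2 • S + ‖W‖ ^ 2 • S) := by abel
  rw [h2, h]
  module

theorem IsOrthogonalCliffordModule.inner_cmul_cmul (horth : IsOrthogonalCliffordModule z v)
    (Z : z) (S T : v) : ⟪cmul Z S, cmul Z T⟫_ℝ = ‖Z‖ ^ 2 * ⟪S, T⟫_ℝ := by
  rw [horth, cmul_cmul, inner_neg_right, neg_neg, inner_smul_right]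

theorem IsOrthogonalCliffordModule.inner_cmul_self (horth : IsOrthogonalCliffordModule z v)
    (Z : z) (S : v) : ⟪cmul Z S, S⟫_ℝ = 0 := by
  have := horth Z S S
  rw [real_inner_comm S (cmul Z S)] at this
  rw [real_inner_comm]
  linarith

variable [FiniteDimensional ℝ z] [FiniteDimensional ℝ v]

theorem IsOrthogonalCliffordModule.inner_hatK_self (horth : IsOrthogonalCliffordModule z v)
    (X : z × v) (Z : z) : ⟪hatK X Z, Z⟫_ℝ = 0 := by
  rw [inner_hatK, horth.inner_cmul_cmul, horth.inner_cmul_self, mul_zero]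

theorem IsOrthogonalCliffordModule.inner_hatK_left (horth : IsOrthogonalCliffordModule z v)
    (X : z × v) (Z W : z) : ⟪hatK X Z, W⟫_ℝ = -⟪Z, hatK X W⟫_ℝ := by
  have h := horth.inner_hatK_self X (Z + W)
  rw [map_add, inner_add_left, inner_add_right, inner_add_right, horth.inner_hatK_self,
    horth.inner_hatK_self, real_inner_comm Z] at h
  linarith

theorem IsOrthogonalCliffordModule.isSymmetric_negHatKSq (horth : IsOrthogonalCliffordModule z v)
    (X : z × v) : (negHatKSq X).IsSymmetric := by
  intro Z W
  simp only [negHatKSq, LinearMap.neg_apply, Module.End.mul_apply, inner_neg_left, inner_neg_right]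
  rw [horth.inner_hatK_left, horth.inner_hatK_left, neg_neg]

/-- `X.1 • X.1 • X.2` is a multiple of `X.2`, which is perpendicular to every `W • X.2`. -/
theorem IsOrthogonalCliffordModule.hatK_fst (horth : IsOrthogonalCliffordModule z v)
    (X : z × v) : hatK X X.1 = 0 := by
  refine ext_inner_right ℝ fun W => ?_
  rw [inner_hatK, cmul_cmul, inner_neg_left, inner_smul_left, real_inner_comm,
    horth.inner_cmul_self, mul_zero, neg_zero, inner_zero_left]

theorem negCheckKSq_eq_smul (X : z × v) :
    negCheckKSq X = (‖X.1‖ ^ 2 * ‖X.2‖ ^ 4)⁻¹ • negHatKSq X := by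
  rw [negCheckKSq, checkK, negHatKSq, smul_mul_smul_comm, ← mul_inv, smul_neg]
  congr 3
  ring

theorem IsOrthogonalCliffordModule.isSymmetric_negCheckKSq
    (horth : IsOrthogonalCliffordModule z v) (X : z × v) : (negCheckKSq X).IsSymmetric := by
  rw [negCheckKSq_eq_smul]
  exact (horth.isSymmetric_negHatKSq X).smul (by simp)

theorem norm_sq_mul_norm_pow_ne_zero {X : z × v} (h1 : X.1 ≠ 0) (h2 : X.2 ≠ 0) :
    ‖X.1‖ ^ 2 * ‖X.2‖ ^ 4 ≠ 0 := by
  have := norm_ne_zero_iff.mpr h1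
  have := norm_ne_zero_iff.mpr h2
  positivity

theorem eigenspace_negCheckKSq {X : z × v} (h1 : X.1 ≠ 0) (h2 : X.2 ≠ 0) (ν : ℝ) :
    (negCheckKSq X).eigenspace ν = (negHatKSq X).eigenspace (‖X.1‖ ^ 2 * ‖X.2‖ ^ 4 * ν) := by
  have hc := norm_sq_mul_norm_pow_ne_zero h1 h2
  rw [negCheckKSq_eq_smul, ← eigenspace_smul_mul (negHatKSq X) (inv_ne_zero hc),
    inv_mul_cancel_left₀ hc]

theorem hasEigenvalue_negCheckKSq_iff {X : z × v} (h1 : X.1 ≠ 0) (h2 : X.2 ≠ 0) (ν : ℝ) :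
    (negCheckKSq X).HasEigenvalue ν ↔
      (negHatKSq X).HasEigenvalue (‖X.1‖ ^ 2 * ‖X.2‖ ^ 4 * ν) := by
  rw [Module.End.hasEigenvalue_iff, Module.End.hasEigenvalue_iff, eigenspace_negCheckKSq h1 h2]

theorem numEigenvalues_eq_card (X : z × v) :
    numEigenvalues X = (eigenvalueFinset (negCheckKSq X)).card := ncard_hasEigenvalue _

theorem numEigenvalues_eq_card_negHatKSq {X : z × v} (h1 : X.1 ≠ 0) (h2 : X.2 ≠ 0) :
    numEigenvalues X = (eigenvalueFinset (negHatKSq X)).card := by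
  rw [numEigenvalues_eq_card, negCheckKSq_eq_smul,
    card_eigenvalueFinset_smul _ (inv_ne_zero (norm_sq_mul_norm_pow_ne_zero h1 h2))]

variable (z v) in
/-- Clifford multiplication as a continuous bilinear map. -/
def cmulL : z →L[ℝ] v →L[ℝ] v :=
  LinearMap.toContinuousLinearMap ((LinearMap.toContinuousLinearMap (𝕜 := ℝ) (E := v) (F' := v)
    : (v →ₗ[ℝ] v) →ₗ[ℝ] (v →L[ℝ] v)) ∘ₗ LinearMap.mk₂ ℝ cmul cmul_add_left cmul_smul_left
      cmul_add_right fun c Z S => cmul_smul_right c Z S)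

theorem ContDiff.cmul {E : Type*} [NormedAddCommGroup E] [NormedSpace ℝ E] {f : E → z} {g : E → v}
    {n : WithTop ℕ∞} (hf : ContDiff ℝ n f) (hg : ContDiff ℝ n g) :
    ContDiff ℝ n fun x => cmul (f x) (g x) :=
  ((cmulL z v).contDiff.comp hf).clm_apply hg

theorem contDiff_inner_hatK (Z W : z) : ContDiff ℝ ω fun X : z × v => ⟪hatK X Z, W⟫_ℝ := by
  simp only [inner_hatK]
  exact (contDiff_const.cmul (contDiff_fst.cmul contDiff_snd)).inner ℝ
    (contDiff_const.cmul contDiff_snd)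

theorem contDiff_hatK :
    ContDiff ℝ ω fun X : z × v => LinearMap.toContinuousLinearMap (hatK X) := by
  rw [contDiff_clm_apply_iff]
  intro Z
  let b := stdOrthonormalBasis ℝ z
  have : (fun X : z × v => LinearMap.toContinuousLinearMap (hatK X) Z) =
      fun X => ∑ i, ⟪hatK X Z, b i⟫_ℝ • b i := by
    funext X
    rw [LinearMap.coe_toContinuousLinearMap', ← b.sum_repr' (hatK X Z)]
    simp only [b.sum_repr', real_inner_comm]
  rw [this]
  exact ContDiff.sum fun i _ => (contDiff_inner_hatK Z (b i)).smul contDiff_const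

theorem contDiff_negHatKSq :
    ContDiff ℝ ω fun X : z × v => LinearMap.toContinuousLinearMap (negHatKSq X) := by
  have : (fun X : z × v => LinearMap.toContinuousLinearMap (negHatKSq X)) = fun X =>
      -(LinearMap.toContinuousLinearMap (hatK X)).comp
        (LinearMap.toContinuousLinearMap (hatK X)) := rfl
  rw [this]
  exact (contDiff_hatK.clm_comp contDiff_hatK).neg

theorem contDiff_norm_sq_mul_norm_pow : ContDiff ℝ ω fun X : z × v => ‖X.1‖ ^ 2 * ‖X.2‖ ^ 4 := by
  have : (fun X : z × v => ‖X.1‖ ^ 2 * ‖X.2‖ ^ 4) = fun X => ‖X.1‖ ^ 2 * (‖X.2‖ ^ 2) ^ 2 := by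
    funext X; ring
  rw [this]
  exact (contDiff_fst.norm_sq ℝ).mul ((contDiff_snd.norm_sq ℝ).pow 2)

theorem contDiffAt_negCheckKSq {X : z × v} (h1 : X.1 ≠ 0) (h2 : X.2 ≠ 0) :
    ContDiffAt ℝ ω (fun X : z × v => LinearMap.toContinuousLinearMap (negCheckKSq X)) X := by
  simp only [negCheckKSq_eq_smul, map_smul]
  exact (contDiff_norm_sq_mul_norm_pow.contDiffAt.inv (norm_sq_mul_norm_pow_ne_zero h1 h2)).smul
    contDiff_negHatKSq.contDiffAt

variable (z v) in
theorem isOpen_fst_ne_zero_and_snd_ne_zero : IsOpen {X : z × v | X.1 ≠ 0 ∧ X.2 ≠ 0} :=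
  (isOpen_ne_fun continuous_fst continuous_const).inter
    (isOpen_ne_fun continuous_snd continuous_const)

/-- If `c` is an eigenvalue of `-Ǩ²` on a nonempty open set, and `K̂` vanishes somewhere on `D`,
then `c = 0`. -/
theorem eq_zero_of_hasEigenvalue_on_open {U : Set (z × v)} (hU : IsOpen U) (hne : U.Nonempty)
    (hUD : ∀ X ∈ U, X.1 ≠ 0 ∧ X.2 ≠ 0) {c : ℝ} (hc : ∀ X ∈ U, (negCheckKSq X).HasEigenvalue c)
    {P : z × v} (hP1 : P.1 ≠ 0) (hP2 : P.2 ≠ 0) (hP : hatK P = 0) : c = 0 := by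
  let b := stdOrthonormalBasis ℝ z
  -- Clearing the denominator gives a family that is analytic on all of the connected space `z × v`,
  -- so that the identity theorem reaches `P` from `U`.
  let T : z × v → Module.End ℝ z := fun X =>
    negHatKSq X - algebraMap ℝ _ (‖X.1‖ ^ 2 * ‖X.2‖ ^ 4 * c)
  have hdet (X : z × v) : LinearMap.det (T X) =
      (Matrix.of fun i j => ⟪b i, T X (b j)⟫_ℝ).det := by
    rw [← LinearMap.det_toMatrix b.toBasis]
    congr 1
    ext i j
    simp [LinearMap.toMatrix_apply, b.repr_apply_apply]
  have hT (Z W : z) : ContDiff ℝ ω fun X => ⟪W, T X Z⟫_ℝ := by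
    simp only [T, LinearMap.sub_apply, Module.algebraMap_end_apply]
    refine contDiff_const.inner ℝ (ContDiff.sub ?_ ?_)
    · exact contDiff_clm_apply_iff.mp contDiff_negHatKSq Z
    · exact (contDiff_norm_sq_mul_norm_pow.mul contDiff_const).smul contDiff_const
  have han : AnalyticOnNhd ℝ (fun X => LinearMap.det (T X)) Set.univ := by
    intro X _
    refine ContDiffAt.analyticAt (ContDiff.contDiffAt ?_)
    simp only [hdet, Matrix.det_apply]
    exact ContDiff.sum fun σ _ => ContDiff.const_smul _ (contDiff_prod fun i _ => hT _ _)
  obtain ⟨X, hX⟩ := hne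
  have hzero : (fun X => LinearMap.det (T X)) =ᶠ[𝓝 X] 0 := by
    filter_upwards [hU.mem_nhds hX] with Y hY
    have h := (hasEigenvalue_negCheckKSq_iff (hUD Y hY).1 (hUD Y hY).2 c).mp (hc Y hY)
    rw [Module.End.hasEigenvalue_iff, Module.End.eigenspace_def] at h
    exact LinearMap.det_eq_zero_iff_ker_ne_bot.mpr h
  have hPz := han.eqOn_zero_of_preconnected_of_eventuallyEq_zero isPreconnected_univ
    (Set.mem_univ X) hzero (Set.mem_univ P)
  by_contra hcne
  have hTP : T P = (-(‖P.1‖ ^ 2 * ‖P.2‖ ^ 4 * c)) • LinearMap.id := by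
    simp only [T, negHatKSq, hP, zero_mul, neg_zero, zero_sub, neg_smul]
    rfl
  have h3 : LinearMap.det (T P) = 0 := hPz
  rw [hTP, LinearMap.det_smul, LinearMap.det_id, mul_one] at h3
  exact mul_ne_zero (norm_sq_mul_norm_pow_ne_zero hP1 hP2) hcne
    (neg_eq_zero.mp (eq_zero_of_pow_eq_zero h3))

end Clifford

/-! ### Eigenvalue branches on components of the unramified set. -/

section Branches

open ContDiff

variable {z v : Type*} [NormedAddCommGroup z] [InnerProductSpace ℝ z]
  [NormedAddCommGroup v] [InnerProductSpace ℝ v] [Module (Cl z) v] [IsScalarTower ℝ (Cl z) v]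
  [FiniteDimensional ℝ z] [FiniteDimensional ℝ v]

/-- The `i`-th smallest eigenvalue of `-Ǩ(X)²` if there are exactly `n` of them. -/
def sortedEigenvalue (n : ℕ) (i : Fin n) (X : z × v) : ℝ :=
  if h : (eigenvalueFinset (negCheckKSq X)).card = n then
    (eigenvalueFinset (negCheckKSq X)).orderEmbOfFin h i else 0

theorem sortedEigenvalue_eq {n : ℕ} {X : z × v}
    (h : (eigenvalueFinset (negCheckKSq X)).card = n) :
    (fun i => sortedEigenvalue n i X) = (eigenvalueFinset (negCheckKSq X)).orderEmbOfFin h := by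
  funext i
  rw [sortedEigenvalue, dif_pos h]

theorem strictMono_sortedEigenvalue {n : ℕ} {X : z × v}
    (h : (eigenvalueFinset (negCheckKSq X)).card = n) :
    StrictMono fun i => sortedEigenvalue n i X := by
  rw [sortedEigenvalue_eq h]
  exact OrderEmbedding.strictMono _

theorem hasEigenvalue_iff_exists_sortedEigenvalue {n : ℕ} {X : z × v}
    (h : (eigenvalueFinset (negCheckKSq X)).card = n) (ν : ℝ) :
    (negCheckKSq X).HasEigenvalue ν ↔ ∃ i, sortedEigenvalue n i X = ν := by
  have := Finset.range_orderEmbOfFin (eigenvalueFinset (negCheckKSq X)) h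
  rw [← sortedEigenvalue_eq h] at this
  rw [← mem_eigenvalueFinset, ← Finset.mem_coe, ← this, Set.mem_range]

/-- Since `n` is the maximum, each eigenvalue at `X` extends to an analytic germ of eigenvalues.
Near `X` these `n` germs stay in strict order, so they exhaust the spectrum and are the sorted
eigenvalues. -/
theorem analyticAt_sortedEigenvalue (horth : IsOrthogonalCliffordModule z v) {n : ℕ}
    (hle : ∀ X : z × v, X.1 ≠ 0 → X.2 ≠ 0 → numEigenvalues X ≤ n) {X : z × v} (h1 : X.1 ≠ 0)
    (h2 : X.2 ≠ 0) (hX : numEigenvalues X = n) (i : Fin n) :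
    AnalyticAt ℝ (sortedEigenvalue (z := z) (v := v) n i) X := by
  have hF := contDiffAt_negCheckKSq h1 h2
  have hsym : ∀ᶠ Y in 𝓝 X, ((LinearMap.toContinuousLinearMap (negCheckKSq Y) : z →L[ℝ] z) :
    z →ₗ[ℝ] z).IsSymmetric := Filter.Eventually.of_forall fun Y => horth.isSymmetric_negCheckKSq Y
  have hD := (isOpen_fst_ne_zero_and_snd_ne_zero z v).mem_nhds ⟨h1, h2⟩
  rw [numEigenvalues_eq_card] at hX
  have hcard : ∀ᶠ Y in 𝓝 X, (eigenvalueFinset (negCheckKSq Y)).card = n := by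
    filter_upwards [hD, eventually_card_eigenvalueFinset_le hF.continuousAt hsym] with Y hY hY2
    have := hle Y hY.1 hY.2
    rw [numEigenvalues_eq_card] at this
    exact le_antisymm this (hX ▸ hY2)
  have hle' : ∀ᶠ Y in 𝓝 X, (eigenvalueFinset
      ((LinearMap.toContinuousLinearMap (negCheckKSq Y) : z →L[ℝ] z) : z →ₗ[ℝ] z)).card ≤
      (eigenvalueFinset
      ((LinearMap.toContinuousLinearMap (negCheckKSq X) : z →L[ℝ] z) : z →ₗ[ℝ] z)).card := by
    filter_upwards [hcard] with Y hY
    exact (hY.trans hX.symm).le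
  have hex (j : Fin n) := exists_analyticAt_hasEigenvalue hF hsym hle'
    ((hasEigenvalue_iff_exists_sortedEigenvalue hX (sortedEigenvalue n j X)).mpr ⟨j, rfl⟩)
  choose g hga hgX hgev using hex
  have hmono : ∀ᶠ Y in 𝓝 X, StrictMono fun j => g j Y := by
    have : ∀ j k : Fin n, ∀ᶠ Y in 𝓝 X, j < k → g j Y < g k Y := by
      intro j k
      by_cases hjk : j < k
      · have hlt : g j X < g k X := by
          rw [hgX, hgX]; exact strictMono_sortedEigenvalue hX hjk
        filter_upwards [(hga j).continuousAt.eventually_lt (hga k).continuousAt hlt] with Y hY _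
        exact hY
      · exact Filter.Eventually.of_forall fun Y h => absurd h hjk
    filter_upwards [Filter.eventually_all.mpr fun j => Filter.eventually_all.mpr (this j)]
      with Y hY j k hjk using hY j k hjk
  refine (hga i).congr ?_
  filter_upwards [hcard, hmono, Filter.eventually_all.mpr hgev] with Y hY hm he
  have h3 := Finset.orderEmbOfFin_unique hY (f := fun j => g j Y)
    (fun j => mem_eigenvalueFinset.mpr (he j)) hm
  rw [← sortedEigenvalue_eq hY] at h3
  exact congrFun h3 i

/-- A locally constant number of eigenvalues must be `n`, because points with at least `n` are
dense. Conversely, at a maximum lower semicontinuity gives local constancy. -/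
theorem unramified_eq (horth : IsOrthogonalCliffordModule z v) {n : ℕ}
    (hle : ∀ X : z × v, X.1 ≠ 0 → X.2 ≠ 0 → numEigenvalues X ≤ n) {X₀ : z × v}
    (hX₀ : n ≤ (eigenvalueFinset (negHatKSq X₀)).card) :
    unramified z v = {X | X.1 ≠ 0 ∧ X.2 ≠ 0 ∧ numEigenvalues X = n} := by
  have hdense := dense_le_card_eigenvalueFinset contDiff_negHatKSq
    (fun Y => horth.isSymmetric_negHatKSq Y) hX₀
  ext X
  refine ⟨fun ⟨h1, h2, h⟩ => ⟨h1, h2, ?_⟩, fun ⟨h1, h2, h⟩ => ⟨h1, h2, ?_⟩⟩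
  · have hD := (isOpen_fst_ne_zero_and_snd_ne_zero z v).mem_nhds ⟨h1, h2⟩
    obtain ⟨Y, hYn, hYD, hY⟩ := hdense.inter_nhds_nonempty (Filter.inter_mem hD h)
    refine le_antisymm (hle X h1 h2) ?_
    have hY' : numEigenvalues Y = numEigenvalues X := hY
    rw [← hY', numEigenvalues_eq_card_negHatKSq hYD.1 hYD.2]
    exact hYn
  · have hD := (isOpen_fst_ne_zero_and_snd_ne_zero z v).mem_nhds ⟨h1, h2⟩
    filter_upwards [hD, eventually_card_eigenvalueFinset_le
      (contDiffAt_negCheckKSq h1 h2).continuousAt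
      (Filter.Eventually.of_forall fun Y => horth.isSymmetric_negCheckKSq Y)] with Y hY hY2
    refine le_antisymm ((hle Y hY.1 hY.2).trans_eq h.symm) ?_
    rw [numEigenvalues_eq_card, numEigenvalues_eq_card]
    exact hY2

theorem isOpen_unramified (z v : Type*) [NormedAddCommGroup z] [InnerProductSpace ℝ z]
    [NormedAddCommGroup v] [InnerProductSpace ℝ v] [Module (Cl z) v] [IsScalarTower ℝ (Cl z) v]
    [FiniteDimensional ℝ z] [FiniteDimensional ℝ v] : IsOpen (unramified z v) := by
  rw [isOpen_iff_mem_nhds]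
  rintro X ⟨h1, h2, h⟩
  filter_upwards [(isOpen_fst_ne_zero_and_snd_ne_zero z v).mem_nhds ⟨h1, h2⟩,
    eventually_eventually_nhds.mpr h, h] with Y hD hY hY2
  refine ⟨hD.1, hD.2, ?_⟩
  filter_upwards [hY] with W hW
  rw [hW, hY2]

/-- The structure of the eigenvalue branches if the maximal number of eigenvalues on `D` is `n`,
`0` is always an eigenvalue, and `K̂` vanishes at some point of `D`. -/
theorem nonconstantBranches_of_isUnramifiedComponent (horth : IsOrthogonalCliffordModule z v)
    {n : ℕ} (hle : ∀ X : z × v, X.1 ≠ 0 → X.2 ≠ 0 → numEigenvalues X ≤ n) {X₀ : z × v}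
    (hX₀ : n ≤ (eigenvalueFinset (negHatKSq X₀)).card)
    (h0 : ∀ X : z × v, X.1 ≠ 0 → X.2 ≠ 0 → (negCheckKSq X).HasEigenvalue 0)
    {P : z × v} (hP1 : P.1 ≠ 0) (hP2 : P.2 ≠ 0) (hP : hatK P = 0)
    {U : Set (z × v)} (hU : IsUnramifiedComponent z v U) :
    (∀ X ∈ U, X.1 ≠ 0 ∧ X.2 ≠ 0 ∧ numEigenvalues X = n) ∧
    (nonconstantBranches U).ncard = n - 1 ∧
    ∀ μ ∈ nonconstantBranches U, ∀ X : U, μ X ≠ 0 ∧ (negCheckKSq (X : z × v)).HasEigenvalue (μ X) := by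
  obtain ⟨W, hW, rfl⟩ := hU
  set U := connectedComponentIn (unramified z v) W with hUdef
  have hUG : ∀ X ∈ U, X.1 ≠ 0 ∧ X.2 ≠ 0 ∧ numEigenvalues X = n := by
    intro X hX
    have := connectedComponentIn_subset _ _ hX
    rwa [unramified_eq horth hle hX₀] at this
  have hUopen : IsOpen U := (isOpen_unramified z v).connectedComponentIn
  have hWU : W ∈ U := mem_connectedComponentIn hW
  have hUpre : IsPreconnected U := isPreconnected_connectedComponentIn
  have hcard (X : U) : (eigenvalueFinset (negCheckKSq (X : z × v))).card = n := by
    rw [← numEigenvalues_eq_card]; exact (hUG X X.2).2.2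
  have han (i : Fin n) : AnalyticOnNhd ℝ (sortedEigenvalue (z := z) (v := v) n i) U :=
    fun X hX => analyticAt_sortedEigenvalue horth hle (hUG X hX).1 (hUG X hX).2.1 (hUG X hX).2.2 i
  let β : Fin n → U → ℝ := fun i X => sortedEigenvalue n i (X : z × v)
  have hβc (i : Fin n) : Continuous (β i) := (han i).continuousOn.domRestrict
  have hβinj (X : U) {i j : Fin n} (h : β i X = β j X) : i = j :=
    (strictMono_sortedEigenvalue (hcard X)).injective h
  have hβ (X : U) (ν : ℝ) : (negCheckKSq (X : z × v)).HasEigenvalue ν ↔ ∃ i, β i X = ν :=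
    hasEigenvalue_iff_exists_sortedEigenvalue (hcard X) ν
  have : PreconnectedSpace U := isPreconnected_iff_preconnectedSpace.mp hUpre
  have hbranch (μ : U → ℝ) (hμ : Continuous μ)
      (he : ∀ X : U, (negCheckKSq (X : z × v)).HasEigenvalue (μ X)) : ∃ i, μ = β i := by
    choose idx hidx using fun X => (hβ X _).mp (he X)
    -- The sorted branches are continuous and pairwise distinct at every point, so a continuous
    -- choice of eigenvalue cannot jump between them.
    have hloc : IsLocallyConstant idx := by
      rw [IsLocallyConstant.iff_eventually_eq]
      intro X
      have : ∀ j : Fin n, ∀ᶠ Y in 𝓝 X, j ≠ idx X → β j Y ≠ μ Y := by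
        intro j
        by_cases hj : j = idx X
        · exact Filter.Eventually.of_forall fun _ h => absurd hj h
        · have hne : β j X ≠ μ X := fun h => hj (hβinj X (h.trans (hidx X).symm))
          filter_upwards [((hβc j).continuousAt.ne_iff_eventually_ne hμ.continuousAt).mp hne]
            with Y hY _ using hY
      filter_upwards [Filter.eventually_all.mpr this] with Y hY
      by_contra hne
      exact hY (idx Y) hne (hidx Y)
    refine ⟨idx ⟨W, hWU⟩, ?_⟩
    funext X
    rw [← hidx X, hloc.apply_eq_of_preconnectedSpace X ⟨W, hWU⟩]
  -- The zero branch is one of the `n` sorted ones; it is the one missing from the count `n - 1`.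
  obtain ⟨i₀, hi₀⟩ := hbranch (fun _ => 0) continuous_const
    fun X => h0 X (hUG X X.2).1 (hUG X X.2).2.1
  have hset : nonconstantBranches U = β '' {i | i ≠ i₀} := by
    ext μ
    constructor
    · rintro ⟨⟨⟨f, hf, hfμ⟩, he⟩, hnc⟩
      have hμ : Continuous μ := by
        have : μ = U.domRestrict f := funext fun X => (hfμ X).symm
        rw [this]; exact hf.continuousOn.domRestrict
      obtain ⟨i, rfl⟩ := hbranch μ hμ he
      refine ⟨i, ?_, rfl⟩
      rintro rfl
      exact hnc ⟨0, fun X => (congrFun hi₀ X).symm⟩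
    · rintro ⟨i, hi, rfl⟩
      refine ⟨⟨⟨sortedEigenvalue n i, han i, fun X => rfl⟩, fun X => (hβ X _).mpr ⟨i, rfl⟩⟩, ?_⟩
      rintro ⟨c, hc⟩
      have hc0 : c = 0 := eq_zero_of_hasEigenvalue_on_open hUopen ⟨W, hWU⟩
        (fun X hX => ⟨(hUG X hX).1, (hUG X hX).2.1⟩)
        (fun X hX => (hβ ⟨X, hX⟩ c).mpr ⟨i, hc ⟨X, hX⟩⟩) hP1 hP2 hP
      exact hi (hβinj ⟨W, hWU⟩ ((hc _).trans (hc0.trans (congrFun hi₀ _))))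
  refine ⟨hUG, ?_, ?_⟩
  · rw [hset, Set.ncard_image_of_injective _ fun i j h => hβinj ⟨W, hWU⟩ (congrFun h _)]
    have : {i | i ≠ i₀} = ((Finset.univ.erase i₀ : Finset (Fin n)) : Set (Fin n)) := by
      ext; simp
    rw [this, Set.ncard_coe_finset, Finset.card_erase_of_mem (Finset.mem_univ _)]
    simp
  · rw [hset]
    rintro _ ⟨i, hi, rfl⟩ X
    exact ⟨fun h => hi (hβinj X (h.trans (congrFun hi₀ X))), (hβ X _).mpr ⟨i, rfl⟩⟩

end Branches

/-! ### Parity of multiplicities for the negative square of a skew operator. -/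

section SkewSquare

variable {V : Type*} [NormedAddCommGroup V] [InnerProductSpace ℝ V] [FiniteDimensional ℝ V]

theorem sum_finrank_eigenspace {T : Module.End ℝ V} (hT : T.IsSymmetric) :
    ∑ ν ∈ eigenvalueFinset T, Module.finrank ℝ (T.eigenspace ν) = Module.finrank ℝ V := by
  have h := Finset.card_eq_sum_card_fiberwise (s := Finset.univ) (t := eigenvalueFinset T)
    (f := hT.eigenvalues rfl)
    (fun i _ => by
      rw [Finset.mem_coe, mem_eigenvalueFinset]
      exact hT.hasEigenvalue_eigenvalues rfl i)
  rw [Finset.card_univ, Fintype.card_fin] at h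
  rw [h]
  exact Finset.sum_congr rfl fun ν _ => (hT.card_filter_eigenvalues_eq rfl ν).symm

variable {K : Module.End ℝ V} (hK : ∀ x y, ⟪K x, y⟫_ℝ = -⟪x, K y⟫_ℝ)
include hK

theorem isSymmetric_neg_mul_self_of_skew : (-(K * K)).IsSymmetric := by
  intro x y
  simp only [LinearMap.neg_apply, Module.End.mul_apply, inner_neg_left, inner_neg_right]
  rw [hK, hK, neg_neg]

theorem pos_of_hasEigenvalue_neg_mul_self {ν : ℝ} (hν : (-(K * K)).HasEigenvalue ν)
    (hne : ν ≠ 0) : 0 < ν := by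
  obtain ⟨x, hx, hx0⟩ := hν.exists_hasEigenvector
  rw [Module.End.mem_eigenspace_iff] at hx
  have h1 : ⟪(-(K * K)) x, x⟫_ℝ = ‖K x‖ ^ 2 := by
    rw [LinearMap.neg_apply, Module.End.mul_apply, inner_neg_left, hK, neg_neg,
      real_inner_self_eq_norm_sq]
  rw [hx, inner_smul_left, real_inner_self_eq_norm_sq] at h1
  have h2 : 0 < ‖x‖ ^ 2 := by have := norm_pos_iff.mpr hx0; positivity
  have h3 : 0 ≤ ν * ‖x‖ ^ 2 := by
    rw [show ν * ‖x‖ ^ 2 = ‖K x‖ ^ 2 from h1]; positivity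
  exact lt_of_le_of_ne (nonneg_of_mul_nonneg_left h3 h2) (Ne.symm hne)

/-- `K` restricts to the eigenspace with square `-ν`. Taking determinants, a square equals `(-ν)` to
the power of the dimension, which would be negative in odd dimension. -/
theorem even_finrank_eigenspace_neg_mul_self {ν : ℝ} (hν : (-(K * K)).HasEigenvalue ν)
    (hne : ν ≠ 0) : Even (Module.finrank ℝ ((-(K * K)).eigenspace ν)) := by
  have hpos := pos_of_hasEigenvalue_neg_mul_self hK hν hne
  set W := (-(K * K)).eigenspace ν
  have hW : ∀ x ∈ W, K x ∈ W := by
    intro x hx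
    rw [Module.End.mem_eigenspace_iff] at hx ⊢
    rw [← map_smul, ← hx]
    simp
  have hsq : K.restrict hW * K.restrict hW = (-ν) • LinearMap.id := by
    ext x
    have hx := Module.End.mem_eigenspace_iff.mp x.2
    rw [LinearMap.neg_apply, neg_eq_iff_eq_neg] at hx
    simpa [LinearMap.restrict_apply] using hx
  have hdet := congrArg LinearMap.det hsq
  rw [map_mul, LinearMap.det_smul, LinearMap.det_id, mul_one] at hdet
  by_contra hodd
  rw [Nat.not_even_iff_odd] at hodd
  rw [hodd.neg_pow] at hdet
  have := pow_pos hpos (Module.finrank ℝ W)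
  nlinarith [mul_self_nonneg (LinearMap.det (K.restrict hW))]

variable (hV : Even (Module.finrank ℝ V)) {x₀ : V} (hx₀ : x₀ ≠ 0) (hKx₀ : K x₀ = 0)
include hx₀ hKx₀

theorem hasEigenvalue_zero_neg_mul_self : (-(K * K)).HasEigenvalue 0 :=
  Module.End.hasEigenvalue_of_hasEigenvector
    ⟨by rw [Module.End.mem_eigenspace_iff]; simp [hKx₀], hx₀⟩

include hV

/-- For `ν = 0` the determinant argument fails; evenness follows from that of `V` and of all other
eigenspaces. -/
theorem two_le_finrank_eigenspace_neg_mul_self {ν : ℝ} (hν : (-(K * K)).HasEigenvalue ν) :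
    2 ≤ Module.finrank ℝ ((-(K * K)).eigenspace ν) := by
  have hposrank : 0 < Module.finrank ℝ ((-(K * K)).eigenspace ν) :=
    Module.finrank_pos_iff.mpr (Submodule.nontrivial_iff_ne_bot.mpr hν)
  suffices Even (Module.finrank ℝ ((-(K * K)).eigenspace ν)) by
    obtain ⟨k, hk⟩ := this
    omega
  by_cases hne : ν = 0
  · subst hne
    have hsum := sum_finrank_eigenspace (isSymmetric_neg_mul_self_of_skew hK)
    rw [← Finset.add_sum_erase _ _ (mem_eigenvalueFinset.mpr hν)] at hsum
    rw [← hsum] at hV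
    refine (Nat.even_add.mp hV).mpr (Finset.even_sum _ fun μ hμ => ?_)
    rw [Finset.mem_erase, mem_eigenvalueFinset] at hμ
    exact even_finrank_eigenspace_neg_mul_self hK hμ.2 hμ.1
  · exact even_finrank_eigenspace_neg_mul_self hK hν hne

theorem two_mul_card_eigenvalueFinset_le :
    2 * (eigenvalueFinset (-(K * K))).card ≤ Module.finrank ℝ V := by
  rw [← sum_finrank_eigenspace (isSymmetric_neg_mul_self_of_skew hK), mul_comm]
  refine Finset.card_nsmul_le_sum _ _ 2 fun ν hν => ?_
  exact two_le_finrank_eigenspace_neg_mul_self hK hV hx₀ hKx₀ (mem_eigenvalueFinset.mp hν)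

theorem finrank_eigenspace_eq_two
    (hcard : 2 * (eigenvalueFinset (-(K * K))).card = Module.finrank ℝ V) {ν : ℝ}
    (hν : (-(K * K)).HasEigenvalue ν) : Module.finrank ℝ ((-(K * K)).eigenspace ν) = 2 := by
  rw [← sum_finrank_eigenspace (isSymmetric_neg_mul_self_of_skew hK), mul_comm, ← smul_eq_mul,
    ← Finset.sum_const] at hcard
  exact ((Finset.sum_eq_sum_iff_of_le fun μ hμ => two_le_finrank_eigenspace_neg_mul_self hK hV hx₀
    hKx₀ (mem_eigenvalueFinset.mp hμ)).mp hcard ν (mem_eigenvalueFinset.mpr hν)).symm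

end SkewSquare

/-! ### Octonions in coordinates. -/

namespace Octonion

theorem ext_coord {x y : Octonion} (h0 : x.fst.re = y.fst.re) (h1 : x.fst.imI = y.fst.imI)
    (h2 : x.fst.imJ = y.fst.imJ) (h3 : x.fst.imK = y.fst.imK) (h4 : x.snd.re = y.snd.re)
    (h5 : x.snd.imI = y.snd.imI) (h6 : x.snd.imJ = y.snd.imJ) (h7 : x.snd.imK = y.snd.imK) :
    x = y := by
  apply WithLp.ofLp_injective 2
  exact Prod.ext (Quaternion.ext _ _ h0 h1 h2 h3) (Quaternion.ext _ _ h4 h5 h6 h7)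

/-- The octonion with given coordinates. -/
def mk (c : Fin 8 → ℝ) : Octonion := WithLp.toLp 2 (⟨c 0, c 1, c 2, c 3⟩, ⟨c 4, c 5, c 6, c 7⟩)

@[simp] theorem mk_fst_re (c : Fin 8 → ℝ) : (mk c).fst.re = c 0 := rfl

@[simp] theorem mk_fst_imI (c : Fin 8 → ℝ) : (mk c).fst.imI = c 1 := rfl

@[simp] theorem mk_fst_imJ (c : Fin 8 → ℝ) : (mk c).fst.imJ = c 2 := rfl

@[simp] theorem mk_fst_imK (c : Fin 8 → ℝ) : (mk c).fst.imK = c 3 := rfl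

@[simp] theorem mk_snd_re (c : Fin 8 → ℝ) : (mk c).snd.re = c 4 := rfl

@[simp] theorem mk_snd_imI (c : Fin 8 → ℝ) : (mk c).snd.imI = c 5 := rfl

@[simp] theorem mk_snd_imJ (c : Fin 8 → ℝ) : (mk c).snd.imJ = c 6 := rfl

@[simp] theorem mk_snd_imK (c : Fin 8 → ℝ) : (mk c).snd.imK = c 7 := rfl

/-- The coordinates of an octonion. -/
def coord (x : Octonion) : Fin 8 → ℝ :=
  ![x.fst.re, x.fst.imI, x.fst.imJ, x.fst.imK, x.snd.re, x.snd.imI, x.snd.imJ, x.snd.imK]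

theorem inner_eq (x y : Octonion) : ⟪x, y⟫_ℝ = ∑ i, coord x i * coord y i := by
  simp [coord, Fin.sum_univ_eight, WithLp.prod_inner_apply, Quaternion.inner_def]
  ring

/-- The standard basis vectors of the octonions. -/
def e (i : Fin 8) : Octonion := mk (Pi.single i 1)

theorem eq_sum (x : Octonion) : x = ∑ i, coord x i • e i := by
  apply ext_coord <;> simp [Fin.sum_univ_eight, coord, e]

theorem orthonormal_e : Orthonormal ℝ e := by
  rw [orthonormal_iff_ite]
  intro i j
  rw [inner_eq]
  fin_cases i <;> fin_cases j <;> simp [Fin.sum_univ_eight, coord, e]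

theorem finrank_eq : Module.finrank ℝ Octonion = 8 := by
  rw [(WithLp.linearEquiv 2 ℝ (ℍ[ℝ] × ℍ[ℝ])).finrank_eq, Module.finrank_prod,
    Quaternion.finrank_eq_four]

theorem conj_mul (x y : Octonion) : conj (mul x y) = mul (conj y) (conj x) := by
  apply ext_coord <;> simp [mul, conj]

@[simp]
theorem conj_conj (x : Octonion) : conj (conj x) = x := by
  apply ext_coord <;> simp [conj]

@[simp]
theorem norm_conj (x : Octonion) : ‖conj x‖ = ‖x‖ := by
  rw [← sq_eq_sq₀ (norm_nonneg _) (norm_nonneg _), ← real_inner_self_eq_norm_sq,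
    ← real_inner_self_eq_norm_sq, inner_eq, inner_eq]
  simp [Fin.sum_univ_eight, coord, conj]

theorem conj_add (x y : Octonion) : conj (x + y) = conj x + conj y := by
  apply ext_coord <;> simp [conj] <;> ring

theorem conj_smul (c : ℝ) (x : Octonion) : conj (c • x) = c • conj x := by
  apply ext_coord <;> simp [conj]

/-- `conj x + x` is twice the real part of `x`, which is its inner product with the unit `e 0`. -/
theorem conj_mul_add_mul (x y : Octonion) :
    mul (conj x) y + mul x y = (2 * ⟪x, e 0⟫_ℝ) • y := by
  rw [inner_eq]
  apply ext_coord <;> simp [mul, conj, Fin.sum_univ_eight, coord, e] <;> ring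

end Octonion

/-! ### Octonionic relations on a single spinor. -/

section Spinor

variable {z v : Type*} [NormedAddCommGroup z] [InnerProductSpace ℝ z]
  [NormedAddCommGroup v] [InnerProductSpace ℝ v] [Module (Cl z) v] [IsScalarTower ℝ (Cl z) v]

theorem cmul_cmul_comm_of_inner_eq_zero {Z W : z} (h : ⟪Z, W⟫_ℝ = 0) (S : v) :
    cmul Z (cmul W S) = -cmul W (cmul Z S) := by
  have := cmul_cmul_add Z W S
  rw [h, mul_zero, zero_smul, neg_zero] at this
  exact eq_neg_of_add_eq_zero_left this

section Relations

variable {u : Fin 8 → z} (hu : Orthonormal ℝ u)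

/-- The relation between `u p • u q • s` and `u 0 • u r • s` that corresponds to `e p * e q = ε e r`
in the octonions. -/
def SpinorRel (u : Fin 8 → z) (s : v) (ε : ℝ) (p q r : Fin 8) : Prop :=
  cmul (u p) (cmul (u q) s) = -(ε • cmul (u 0) (cmul (u r) s))

include hu

theorem cmul_self_of_orthonormal (p : Fin 8) (S : v) : cmul (u p) (cmul (u p) S) = -S := by
  rw [cmul_cmul, hu.norm_eq_one]; simp

theorem cmul_comm_of_orthonormal {p q : Fin 8} (h : p ≠ q) (S : v) :
    cmul (u p) (cmul (u q) S) = -cmul (u q) (cmul (u p) S) :=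
  cmul_cmul_comm_of_inner_eq_zero (hu.inner_eq_zero h) S

theorem SpinorRel.swap {s : v} {ε : ℝ} {p q r : Fin 8} (h : SpinorRel u s ε p q r) (hpq : p ≠ q) :
    SpinorRel u s (-ε) q p r := by
  rw [SpinorRel] at h ⊢
  rw [cmul_comm_of_orthonormal hu hpq.symm, h, neg_smul]

theorem SpinorRel.rotate {s : v} {ε : ℝ} {p q r : Fin 8} (h : SpinorRel u s ε p q r) (hε : ε ^ 2 = 1)
    (hpq : p ≠ q) (hq : q ≠ 0) : SpinorRel u s ε q r p := by
  rw [SpinorRel] at h ⊢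
  have h1 := congrArg (fun S => cmul (u 0) (cmul (u q) S)) h
  simp only [cmul_neg_right, cmul_smul_right] at h1
  rw [cmul_comm_of_orthonormal hu hpq, cmul_neg_right, cmul_self_of_orthonormal hu, neg_neg,
    cmul_comm_of_orthonormal hu hq (cmul (u r) s), cmul_neg_right,
    cmul_self_of_orthonormal hu 0, neg_neg] at h1
  rw [h1, smul_neg, neg_neg, smul_smul, ← pow_two, hε, one_smul]

/-- The Clifford counterpart of `e p * (e x * e y) = -(e x * (e p * e y))`, the linearized
alternative law for anticommuting units. It produces new lines of the Fano plane from known ones. -/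
theorem SpinorRel.comp {s : v} {ε₁ ε₂ ε₃ : ℝ} {x y q p w r : Fin 8} (h₁ : SpinorRel u s ε₁ x y q)
    (h₂ : SpinorRel u s ε₂ p y w) (h₃ : SpinorRel u s ε₃ x w r) (hε : ε₁ ^ 2 = 1) (hp : p ≠ 0)
    (hx : x ≠ 0) (hpx : p ≠ x) : SpinorRel u s (-(ε₁ * ε₂ * ε₃)) p q r := by
  rw [SpinorRel] at h₁ h₂ h₃ ⊢
  have h4 : cmul (u q) s = ε₁ • cmul (u 0) (cmul (u x) (cmul (u y) s)) := by
    rw [h₁, cmul_neg_right, cmul_smul_right, cmul_self_of_orthonormal hu, smul_neg, smul_neg, smul_neg, neg_neg,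
      smul_smul, ← pow_two, hε, one_smul]
  rw [h4, cmul_smul_right, cmul_comm_of_orthonormal hu hp, cmul_comm_of_orthonormal hu hpx,
    cmul_neg_right, neg_neg, h₂, cmul_neg_right, cmul_smul_right,
    cmul_comm_of_orthonormal hu hx, cmul_neg_right, cmul_smul_right, cmul_neg_right,
    cmul_self_of_orthonormal hu, h₃]
  module

/-- Replace a spinor in an invariant subspace by one that satisfies one more relation. -/
theorem exists_spinorRel (N : Submodule (Cl z) v) {s : v} (hs : s ∈ N) (hs0 : s ≠ 0)
    {p q r : Fin 8} (hp : p ≠ 0) (hq : q ≠ 0) (hr : r ≠ 0) (hpq : p ≠ q) (hpr : p ≠ r) (hqr : q ≠ r) :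
    ∃ s' ∈ N, s' ≠ 0 ∧ SpinorRel u s' 1 p q r ∧
      (s' = s + cmul (u 0) (cmul (u r) (cmul (u p) (cmul (u q) s))) ∨ s' = cmul (u r) s) := by
  have hN (Z : z) {S : v} (hS : S ∈ N) : cmul Z S ∈ N := N.smul_mem _ hS
  have ac {a b : Fin 8} (h : a ≠ b) (S : v) := cmul_comm_of_orthonormal hu h S
  have sq (a : Fin 8) (S : v) := cmul_self_of_orthonormal hu a S
  -- The word `ω = u 0 u r u p u q` squares to 1, and the relation says `ω s' = s'`. If `s + ω s`
  -- vanishes, then `ω s = -s`, and `u r`, which anticommutes with `ω`, moves `s` to the eigenvalue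
  -- 1.
  by_cases h : s + cmul (u 0) (cmul (u r) (cmul (u p) (cmul (u q) s))) = 0
  · refine ⟨cmul (u r) s, hN _ hs, ?_, ?_, Or.inr rfl⟩
    · intro h0
      have := sq r s
      rw [h0, cmul_zero_right] at this
      exact hs0 (by simpa using this.symm)
    · rw [SpinorRel, one_smul, sq, cmul_neg_right, neg_neg, ac hqr, cmul_neg_right, ac hpr, neg_neg]
      have h2 := congrArg (cmul (u 0)) h
      rw [cmul_add_right, sq, cmul_zero_right, add_neg_eq_zero] at h2
      exact h2.symm
  · refine ⟨_, N.add_mem hs (hN _ (hN _ (hN _ (hN _ hs)))), h, ?_, Or.inl rfl⟩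
    have e1 : cmul (u p) (cmul (u q) (cmul (u 0) (cmul (u r) (cmul (u p) (cmul (u q) s))))) =
        -cmul (u 0) (cmul (u r) s) := by
      rw [ac hq, ac hqr, cmul_neg_right, cmul_neg_right, cmul_neg_right, ac hp, ac hpr]
      simp only [cmul_neg_right, neg_neg]
      rw [ac hpq.symm (cmul (u q) s), sq]
      simp only [cmul_neg_right, neg_neg]
      rw [sq, cmul_neg_right, cmul_neg_right]
    have e2 : cmul (u 0) (cmul (u r) (cmul (u 0) (cmul (u r) (cmul (u p) (cmul (u q) s))))) =
        -cmul (u p) (cmul (u q) s) := by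
      rw [ac hr, cmul_neg_right, sq, neg_neg, sq]
    rw [SpinorRel, one_smul]
    simp only [cmul_add_right]
    rw [e1, e2]
    abel

end Relations

end Spinor

/-! ### Existence of spinors obeying the octonionic multiplication table. -/

section SpinorExistence

variable {z v : Type*} [NormedAddCommGroup z] [InnerProductSpace ℝ z]
  [NormedAddCommGroup v] [InnerProductSpace ℝ v] [Module (Cl z) v] [IsScalarTower ℝ (Cl z) v]

section Relations

variable {u : Fin 8 → z} (hu : Orthonormal ℝ u)
include hu

/-- A vector outside the word changes sign four times, a letter of the word only three times. -/
theorem cmul_word_comm {p q r : Fin 8} (hp : p ≠ 0) (hq : q ≠ 0) (hr : r ≠ 0) (hpq : p ≠ q)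
    (hpr : p ≠ r) (hqr : q ≠ r) (a : Fin 8) (S : v) :
    cmul (u a) (cmul (u 0) (cmul (u r) (cmul (u p) (cmul (u q) S)))) =
      (if a = 0 ∨ a = r ∨ a = p ∨ a = q then -1 else 1 : ℝ) •
        cmul (u 0) (cmul (u r) (cmul (u p) (cmul (u q) (cmul (u a) S)))) := by
  have ac {a b : Fin 8} (h : a ≠ b) (S : v) := cmul_comm_of_orthonormal hu h S
  split_ifs with h
  · rw [neg_one_smul]
    rcases h with rfl | rfl | rfl | rfl
    · rw [ac hq, cmul_neg_right, ac hp, neg_neg, ac hr, cmul_neg_right, neg_neg]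
    · rw [ac hr, ac hqr, cmul_neg_right, ac hpr]
      simp only [neg_neg]
    · rw [ac hp, ac hpr, cmul_neg_right, ac hpq.symm]
      simp only [cmul_neg_right, neg_neg]
    · rw [ac hq, ac hqr, cmul_neg_right, ac hpq.symm]
      simp only [cmul_neg_right, neg_neg]
  · push Not at h
    rw [one_smul, ac h.1, ac h.2.1, cmul_neg_right, ac h.2.2.1, ac h.2.2.2]
    simp only [cmul_neg_right, neg_neg]

/-- The sign condition `hσ` says that the words of the two relations commute (the index 0
contributes the minus sign). Projecting for the new relation then preserves the old one. -/
theorem SpinorRel.add_word {s : v} {p' q' r' : Fin 8} (h : SpinorRel u s 1 p' q' r')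
    {p q r : Fin 8} (hp : p ≠ 0) (hq : q ≠ 0) (hr : r ≠ 0) (hpq : p ≠ q)
    (hpr : p ≠ r) (hqr : q ≠ r)
    (hσ : (if p' = 0 ∨ p' = r ∨ p' = p ∨ p' = q then -1 else 1 : ℝ) *
      (if q' = 0 ∨ q' = r ∨ q' = p ∨ q' = q then -1 else 1 : ℝ) =
      -(if r' = 0 ∨ r' = r ∨ r' = p ∨ r' = q then -1 else 1 : ℝ)) :
    SpinorRel u (s + cmul (u 0) (cmul (u r) (cmul (u p) (cmul (u q) s)))) 1 p' q' r' := by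
  have wc := fun (a : Fin 8) (S : v) => cmul_word_comm hu hp hq hr hpq hpr hqr a S
  rw [SpinorRel, one_smul] at h ⊢
  simp only [cmul_add_right]
  rw [wc q', cmul_smul_right, wc p', h, wc r', cmul_smul_right, wc 0, smul_smul, mul_comm, hσ]
  simp [cmul_neg_right]
  exact add_comm _ _

theorem SpinorRel.cmul_right {s : v} {p q r : Fin 8} (h : SpinorRel u s 1 p q r) {a : Fin 8}
    (h0 : a ≠ 0) (hp : a ≠ p) (hq : a ≠ q) (hr : a ≠ r) :
    SpinorRel u (cmul (u a) s) 1 p q r := by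
  have ac {a b : Fin 8} (h : a ≠ b) (S : v) := cmul_comm_of_orthonormal hu h S
  rw [SpinorRel, one_smul] at h ⊢
  rw [ac hq.symm, ac hr.symm, cmul_neg_right, cmul_neg_right, ac hp.symm, ac h0.symm, h,
    cmul_neg_right]

/-- Every nonzero invariant subspace contains a spinor that satisfies the seven relations given by
the multiplication table of the octonions. -/
theorem exists_spinorRel_all (N : Submodule (Cl z) v) (hN : N ≠ ⊥) :
    ∃ s ∈ N, s ≠ 0 ∧ SpinorRel u s 1 1 2 3 ∧ SpinorRel u s 1 1 4 5 ∧ SpinorRel u s 1 2 4 6 ∧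
      SpinorRel u s 1 6 1 7 := by
  obtain ⟨s₀, hs₀, h₀⟩ := N.exists_mem_ne_zero_of_ne_bot hN
  -- The index sets 0123, 0145, 0246, 0167 meet pairwise in two elements, so the four words commute.
  -- Each new `r` (5, then 6, then 7) avoids all earlier index sets, so multiplying by `u r` also
  -- keeps the earlier relations.
  obtain ⟨s₁, hs₁, h₁, r₁, -⟩ := exists_spinorRel hu N hs₀ h₀ (p := 1) (q := 2) (r := 3)
    (by decide) (by decide) (by decide) (by decide) (by decide) (by decide)
  obtain ⟨s₂, hs₂, h₂, r₂, e₂⟩ := exists_spinorRel hu N hs₁ h₁ (p := 1) (q := 4) (r := 5)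
    (by decide) (by decide) (by decide) (by decide) (by decide) (by decide)
  have r₂₁ : SpinorRel u s₂ 1 1 2 3 := by
    rcases e₂ with rfl | rfl
    · exact r₁.add_word hu (by decide) (by decide) (by decide) (by decide) (by decide) (by decide)
        (by simp +decide)
    · exact r₁.cmul_right hu (by decide) (by decide) (by decide) (by decide)
  obtain ⟨s₃, hs₃, h₃, r₃, e₃⟩ := exists_spinorRel hu N hs₂ h₂ (p := 2) (q := 4) (r := 6)
    (by decide) (by decide) (by decide) (by decide) (by decide) (by decide)
  have r₃₁₂ : SpinorRel u s₃ 1 1 2 3 ∧ SpinorRel u s₃ 1 1 4 5 := by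
    rcases e₃ with rfl | rfl
    · exact ⟨r₂₁.add_word hu (by decide) (by decide) (by decide) (by decide) (by decide)
        (by decide) (by simp +decide), r₂.add_word hu (by decide) (by decide) (by decide) (by decide)
        (by decide) (by decide) (by simp +decide)⟩
    · exact ⟨r₂₁.cmul_right hu (by decide) (by decide) (by decide) (by decide),
        r₂.cmul_right hu (by decide) (by decide) (by decide) (by decide)⟩
  obtain ⟨s₄, hs₄, h₄, r₄, e₄⟩ := exists_spinorRel hu N hs₃ h₃ (p := 6) (q := 1) (r := 7)
    (by decide) (by decide) (by decide) (by decide) (by decide) (by decide)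
  refine ⟨s₄, hs₄, h₄, ?_, ?_, ?_, r₄⟩
  all_goals
    rcases e₄ with rfl | rfl
    · first
      | exact r₃₁₂.1.add_word hu (by decide) (by decide) (by decide) (by decide) (by decide)
          (by decide) (by simp +decide)
      | exact r₃₁₂.2.add_word hu (by decide) (by decide) (by decide) (by decide) (by decide)
          (by decide) (by simp +decide)
      | exact r₃.add_word hu (by decide) (by decide) (by decide) (by decide) (by decide)
          (by decide) (by simp +decide)
    · first
      | exact r₃₁₂.1.cmul_right hu (by decide) (by decide) (by decide) (by decide)
      | exact r₃₁₂.2.cmul_right hu (by decide) (by decide) (by decide) (by decide)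
      | exact r₃.cmul_right hu (by decide) (by decide) (by decide) (by decide)

/-- One relation determines all six ordered products along a Fano line, in a form usable as rewrite
rules. -/
theorem SpinorRel.all {s : v} {p q r : Fin 8} (h : SpinorRel u s 1 p q r) (hpq : p ≠ q)
    (hqr : q ≠ r) (hpr : p ≠ r) (hq : q ≠ 0) (hr : r ≠ 0) :
    (cmul (u p) (cmul (u q) s) = -cmul (u 0) (cmul (u r) s) ∧
      cmul (u q) (cmul (u p) s) = cmul (u 0) (cmul (u r) s)) ∧
    (cmul (u q) (cmul (u r) s) = -cmul (u 0) (cmul (u p) s) ∧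
      cmul (u r) (cmul (u q) s) = cmul (u 0) (cmul (u p) s)) ∧
    (cmul (u r) (cmul (u p) s) = -cmul (u 0) (cmul (u q) s) ∧
      cmul (u p) (cmul (u r) s) = cmul (u 0) (cmul (u q) s)) := by
  have h' := h.rotate hu (by norm_num) hpq hq
  have h'' := h'.rotate hu (by norm_num) hqr hr
  have k := h.swap hu hpq
  have k' := h'.swap hu hqr
  have k'' := h''.swap hu hpr.symm
  simp only [SpinorRel, one_smul, neg_smul, neg_neg] at h h' h'' k k' k''
  exact ⟨⟨h, k⟩, ⟨h', k'⟩, h'', k''⟩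

end Relations

/-- A spinor `s` on which `z ≅ 𝕆` acts by the octonionic multiplication table. -/
def IsOctonionicSpinor (ψ : z ≃ₗᵢ[ℝ] Octonion) (s : v) : Prop :=
  ∀ a b : Octonion, cmul (ψ.symm a) (cmul (ψ.symm b) s) =
    cmul (ψ.symm (Octonion.e 0)) (cmul (ψ.symm (Octonion.mul (Octonion.conj a) b)) s)

theorem symm_eq_sum (ψ : z ≃ₗᵢ[ℝ] Octonion) (a : Octonion) :
    ψ.symm a = ∑ i, Octonion.coord a i • ψ.symm (Octonion.e i) := by
  conv_lhs => rw [Octonion.eq_sum a]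
  simp

theorem coord_mul_conj (a b : Octonion) : Octonion.coord (Octonion.mul (Octonion.conj a) b) =
    let x := Octonion.coord a
    let y := Octonion.coord b
    ![x 0 * y 0 + x 1 * y 1 + x 2 * y 2 + x 3 * y 3 + x 4 * y 4 + x 5 * y 5 + x 6 * y 6 + x 7 * y 7,
      x 0 * y 1 - x 1 * y 0 - x 2 * y 3 + x 3 * y 2 - x 4 * y 5 + x 5 * y 4 + x 6 * y 7 - x 7 * y 6,
      x 0 * y 2 + x 1 * y 3 - x 2 * y 0 - x 3 * y 1 - x 4 * y 6 - x 5 * y 7 + x 6 * y 4 + x 7 * y 5,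
      x 0 * y 3 - x 1 * y 2 + x 2 * y 1 - x 3 * y 0 - x 4 * y 7 + x 5 * y 6 - x 6 * y 5 + x 7 * y 4,
      x 0 * y 4 + x 1 * y 5 + x 2 * y 6 + x 3 * y 7 - x 4 * y 0 - x 5 * y 1 - x 6 * y 2 - x 7 * y 3,
      x 0 * y 5 - x 1 * y 4 + x 2 * y 7 - x 3 * y 6 + x 4 * y 1 - x 5 * y 0 + x 6 * y 3 - x 7 * y 2,
      x 0 * y 6 - x 1 * y 7 - x 2 * y 4 + x 3 * y 5 + x 4 * y 2 - x 5 * y 3 - x 6 * y 0 + x 7 * y 1,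
      x 0 * y 7 + x 1 * y 6 - x 2 * y 5 - x 3 * y 4 + x 4 * y 3 + x 5 * y 2 - x 6 * y 1 - x 7 * y 0] := by
  funext i
  fin_cases i <;> simp [Octonion.coord, Octonion.mul, Octonion.conj] <;> ring

theorem isOctonionicSpinor_of_spinorRel (ψ : z ≃ₗᵢ[ℝ] Octonion) {s : v}
    {u : Fin 8 → z} (hψ : ∀ i, ψ.symm (Octonion.e i) = u i) (hu : Orthonormal ℝ u)
    (h123 : SpinorRel u s 1 1 2 3) (h145 : SpinorRel u s 1 1 4 5) (h246 : SpinorRel u s 1 2 4 6)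
    (h617 : SpinorRel u s 1 6 1 7) : IsOctonionicSpinor ψ s := by
  have h514 := (h145.rotate hu (by norm_num) (by decide) (by decide)).rotate hu (by norm_num)
    (by decide) (by decide)
  have h624 := (h246.rotate hu (by norm_num) (by decide) (by decide)).rotate hu (by norm_num)
    (by decide) (by decide)
  have h321 := (h123.rotate hu (by norm_num) (by decide) (by decide)).swap hu (by decide)
  have h347 := h624.comp hu h321 h617 (by norm_num) (by decide) (by decide) (by decide)
  have h257 := (h145.swap hu (by decide)).comp hu (h123.swap hu (by decide))
    (h347.swap hu (by decide)) (by norm_num) (by decide) (by decide) (by decide)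
  have h275 := ((h257.rotate hu (by norm_num) (by decide) (by decide)).rotate hu (by norm_num)
    (by decide) (by decide)).swap hu (by decide)
  have h365 := h246.comp hu h347 h275 (by norm_num) (by decide) (by decide) (by decide)
  norm_num at h347 h257 h365
  obtain ⟨⟨a1, a2⟩, ⟨a3, a4⟩, a5, a6⟩ := h123.all hu (by decide) (by decide) (by decide)
    (by decide) (by decide)
  obtain ⟨⟨b1, b2⟩, ⟨b3, b4⟩, b5, b6⟩ := h145.all hu (by decide) (by decide) (by decide)
    (by decide) (by decide)
  obtain ⟨⟨c1, c2⟩, ⟨c3, c4⟩, c5, c6⟩ := h246.all hu (by decide) (by decide) (by decide)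
    (by decide) (by decide)
  obtain ⟨⟨d1, d2⟩, ⟨d3, d4⟩, d5, d6⟩ := h617.all hu (by decide) (by decide) (by decide)
    (by decide) (by decide)
  obtain ⟨⟨e1, e2⟩, ⟨e3, e4⟩, e5, e6⟩ := h347.all hu (by decide) (by decide) (by decide)
    (by decide) (by decide)
  obtain ⟨⟨f1, f2⟩, ⟨f3, f4⟩, f5, f6⟩ := h257.all hu (by decide) (by decide) (by decide)
    (by decide) (by decide)
  obtain ⟨⟨g1, g2⟩, ⟨g3, g4⟩, g5, g6⟩ := h365.all hu (by decide) (by decide) (by decide)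
    (by decide) (by decide)
  have t0 {a : Fin 8} (h : a ≠ 0) := cmul_comm_of_orthonormal hu h s
  have t1 := t0 (a := 1) (by decide)
  have t2 := t0 (a := 2) (by decide)
  have t3 := t0 (a := 3) (by decide)
  have t4 := t0 (a := 4) (by decide)
  have t5 := t0 (a := 5) (by decide)
  have t6 := t0 (a := 6) (by decide)
  have t7 := t0 (a := 7) (by decide)
  have tt := fun a => cmul_self_of_orthonormal hu a s
  intro a b
  rw [symm_eq_sum ψ a, symm_eq_sum ψ b, symm_eq_sum ψ (Octonion.mul _ _), coord_mul_conj]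
  simp only [hψ, Fin.sum_univ_eight, cmul_add_left, cmul_smul_left, cmul_add_right,
    cmul_smul_right, a1, a2, a3, a4, a5, a6, b1, b2, b3, b4, b5, b6, c1, c2, c3, c4, c5, c6,
    d1, d2, d3, d4, d5, d6, e1, e2, e3, e4, e5, e6, f1, f2, f3, f4, f5, f6,
    g1, g2, g3, g4, g5, g6, t1, t2, t3, t4, t5, t6, t7, tt]
  simp
  module

end SpinorExistence

/-! ### Copies of the octonionic model inside a Clifford module. -/

section SpinorMap

variable {z v : Type*} [NormedAddCommGroup z] [InnerProductSpace ℝ z]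
  [NormedAddCommGroup v] [InnerProductSpace ℝ v] [Module (Cl z) v] [IsScalarTower ℝ (Cl z) v]

/-- A real subspace that is invariant under Clifford multiplication is a `Cl(z)`-submodule. -/
def submoduleOfCmulMem (W : Submodule ℝ v) (h : ∀ (Z : z), ∀ S ∈ W, cmul Z S ∈ W) :
    Submodule (Cl z) v where
  carrier := W
  add_mem' := W.add_mem
  zero_mem' := W.zero_mem
  smul_mem' c S hS := by
    induction c using CliffordAlgebra.induction generalizing S with
    | algebraMap r => rw [algebraMap_smul]; exact W.smul_mem r hS
    | ι Z => exact h Z S hS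
    | mul a b ha hb => rw [mul_smul]; exact ha _ (hb _ hS)
    | add a b ha hb => rw [add_smul]; exact W.add_mem (ha _ hS) (hb _ hS)

@[simp]
theorem mem_submoduleOfCmulMem {W : Submodule ℝ v} {h : ∀ (Z : z), ∀ S ∈ W, cmul Z S ∈ W} {S : v} :
    S ∈ submoduleOfCmulMem W h ↔ S ∈ W := Iff.rfl

/-- The linear map `𝕆 ⊕ 𝕆 → v` generated by a spinor. -/
def spinorMap (ψ : z ≃ₗᵢ[ℝ] Octonion) (s : v) : OctonionSq →ₗ[ℝ] v where
  -- The conjugations and signs are those for which `octCmul` corresponds to Clifford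
  -- multiplication.
  toFun S := -cmul (ψ.symm (Octonion.e 0)) (cmul (ψ.symm (Octonion.conj S.fst)) s) -
    cmul (ψ.symm (Octonion.conj S.snd)) s
  map_add' S T := by
    simp only [WithLp.add_fst, WithLp.add_snd, Octonion.conj_add, map_add, cmul_add_left,
      cmul_add_right]
    abel
  map_smul' c S := by
    simp only [WithLp.smul_fst, WithLp.smul_snd, Octonion.conj_smul, map_smul, cmul_smul_left,
      cmul_smul_right, RingHom.id_apply]
    module

theorem spinorMap_apply (ψ : z ≃ₗᵢ[ℝ] Octonion) (s : v) (S : OctonionSq) :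
    spinorMap ψ s S = -cmul (ψ.symm (Octonion.e 0)) (cmul (ψ.symm (Octonion.conj S.fst)) s) -
    cmul (ψ.symm (Octonion.conj S.snd)) s := rfl

theorem spinorMap_mem (ψ : z ≃ₗᵢ[ℝ] Octonion) {N : Submodule (Cl z) v} {s : v} (hs : s ∈ N)
    (S : OctonionSq) : spinorMap ψ s S ∈ N :=
  N.sub_mem (N.neg_mem (N.smul_mem _ (N.smul_mem _ hs))) (N.smul_mem _ hs)

variable {ψ : z ≃ₗᵢ[ℝ] Octonion} {s : v}

/-- Moving `e 0` to the left by the Clifford relation produces `conj a * b` minus twice the real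
part of `a` times `b`, that is, `-(a * b)`. -/
theorem IsOctonionicSpinor.cmul_cmul_e_cmul (hs : IsOctonionicSpinor ψ s) (a b : Octonion) :
    cmul (ψ.symm a) (cmul (ψ.symm (Octonion.e 0)) (cmul (ψ.symm b) s)) =
      -cmul (ψ.symm (Octonion.mul a b)) s := by
  have h1 := cmul_cmul_add (ψ.symm a) (ψ.symm (Octonion.e 0)) (cmul (ψ.symm b) s)
  rw [hs a b, cmul_cmul, ψ.symm.norm_map, ψ.symm.inner_map_map,
    Octonion.orthonormal_e.norm_eq_one, one_pow, one_smul] at h1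
  have h2 := congrArg (fun x => cmul (ψ.symm x) s) (Octonion.conj_mul_add_mul a b)
  simp only [map_add, map_smul, cmul_add_left, cmul_smul_left] at h2
  rw [← h2, ← sub_eq_add_neg, sub_eq_iff_eq_add] at h1
  rw [h1]
  abel

theorem IsOctonionicSpinor.cmul_spinorMap (hs : IsOctonionicSpinor ψ s) (Z : z) (S : OctonionSq) :
    cmul Z (spinorMap ψ s S) = spinorMap ψ s (octCmul (ψ Z) S) := by
  obtain ⟨a, rfl⟩ := ψ.symm.surjective Z
  rw [ψ.apply_symm_apply]
  simp only [spinorMap_apply, octCmul, WithLp.toLp_fst, WithLp.toLp_snd]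
  rw [cmul_sub_right, cmul_neg_right, hs.cmul_cmul_e_cmul, neg_neg, hs a]
  have h1 : Octonion.conj (-Octonion.mul S.fst (Octonion.conj a)) =
      -Octonion.mul a (Octonion.conj S.fst) := by
    rw [← neg_one_smul ℝ, Octonion.conj_smul, Octonion.conj_mul, Octonion.conj_conj, neg_one_smul]
  rw [h1, Octonion.conj_mul, map_neg, cmul_neg_left]
  abel

/-- The two halves are orthogonal: by skewness their inner product reduces to one of the form `⟪Z •
s, s⟫ = 0`. -/
theorem IsOctonionicSpinor.norm_spinorMap (hs : IsOctonionicSpinor ψ s) (hs1 : ‖s‖ = 1)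
    (horth : IsOrthogonalCliffordModule z v) (S : OctonionSq) : ‖spinorMap ψ s S‖ = ‖S‖ := by
  have hn (a : Octonion) (T : v) : ‖cmul (ψ.symm a) T‖ ^ 2 = ‖a‖ ^ 2 * ‖T‖ ^ 2 := by
    rw [← real_inner_self_eq_norm_sq, horth.inner_cmul_cmul, ψ.symm.norm_map,
      real_inner_self_eq_norm_sq]
  rw [← sq_eq_sq₀ (norm_nonneg _) (norm_nonneg _), spinorMap_apply, norm_sub_sq_real, norm_neg,
    hn, hn, hn, inner_neg_left, horth, neg_neg, horth, hs.cmul_cmul_e_cmul, inner_neg_right,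
    real_inner_comm, horth.inner_cmul_self, hs1, Octonion.orthonormal_e.norm_eq_one,
    Octonion.norm_conj, Octonion.norm_conj, WithLp.prod_norm_sq_eq_of_L2 S]
  ring

theorem IsOctonionicSpinor.inner_spinorMap (hs : IsOctonionicSpinor ψ s) (hs1 : ‖s‖ = 1)
    (horth : IsOrthogonalCliffordModule z v) (S T : OctonionSq) :
    ⟪spinorMap ψ s S, spinorMap ψ s T⟫_ℝ = ⟪S, T⟫_ℝ :=
  LinearIsometry.inner_map_map ⟨spinorMap ψ s, hs.norm_spinorMap hs1 horth⟩ S T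

theorem IsOctonionicSpinor.smul (hs : IsOctonionicSpinor ψ s) (c : ℝ) :
    IsOctonionicSpinor ψ (c • s) := by
  intro a b
  simp only [cmul_smul_right, hs a b]

/-- Every nonzero `Cl(z)`-submodule contains an octonionic unit spinor. -/
theorem exists_isOctonionicSpinor (ψ : z ≃ₗᵢ[ℝ] Octonion) {N : Submodule (Cl z) v} (hN : N ≠ ⊥) :
    ∃ s ∈ N, ‖s‖ = 1 ∧ IsOctonionicSpinor ψ s := by
  have hu : Orthonormal ℝ fun i => ψ.symm (Octonion.e i) :=
    Octonion.orthonormal_e.comp_linearIsometryEquiv ψ.symm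
  obtain ⟨s, hs, hs0, h1, h2, h3, h4⟩ := exists_spinorRel_all hu N hN
  refine ⟨‖s‖⁻¹ • s, ?_, ?_,
    (isOctonionicSpinor_of_spinorRel ψ (fun _ => rfl) hu h1 h2 h3 h4).smul _⟩
  · rw [← algebraMap_smul (Cl z)]
    exact N.smul_mem _ hs
  · rw [norm_smul, norm_inv, norm_norm, inv_mul_cancel₀ (norm_ne_zero_iff.mpr hs0)]

theorem nonempty_linearIsometryEquiv_octonion [FiniteDimensional ℝ z]
    (hdim : Module.finrank ℝ z = 8) : Nonempty (z ≃ₗᵢ[ℝ] Octonion) :=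
  ⟨(stdOrthonormalBasis ℝ z).equiv (stdOrthonormalBasis ℝ Octonion)
    (finCongr (hdim.trans Octonion.finrank_eq.symm))⟩

/-- An irreducible orthogonal `Cl(z)`-module, with `dim z = 8`, is the octonionic model. -/
theorem nonempty_octonionicModel [FiniteDimensional ℝ z] [Nontrivial v]
    (horth : IsOrthogonalCliffordModule z v) (hdim : Module.finrank ℝ z = 8)
    (hsimple : IsSimpleModule (Cl z) v) : Nonempty (OctonionicModel z v) := by
  obtain ⟨ψ⟩ := nonempty_linearIsometryEquiv_octonion hdim
  obtain ⟨s, -, hs1, hs⟩ := exists_isOctonionicSpinor (v := v) ψ (N := ⊤) top_ne_bot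
  let N : Submodule (Cl z) v := submoduleOfCmulMem (LinearMap.range (spinorMap ψ s)) (by
    rintro Z _ ⟨S, rfl⟩
    exact ⟨_, (hs.cmul_spinorMap Z S).symm⟩)
  have hiso : ∀ S, ‖spinorMap ψ s S‖ = ‖S‖ := hs.norm_spinorMap hs1 horth
  -- The image is an invariant subspace, nonzero because the map is isometric, so irreducibility
  -- makes it everything.
  have hN : N = ⊤ := by
    refine (eq_bot_or_eq_top N).resolve_left fun hbot => ?_
    let S : OctonionSq := WithLp.toLp 2 (Octonion.e 0, 0)
    have hmem : spinorMap ψ s S ∈ N := ⟨S, rfl⟩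
    rw [hbot, Submodule.mem_bot] at hmem
    have h := hiso S
    rw [hmem, norm_zero] at h
    have h2 := WithLp.prod_norm_sq_eq_of_L2 S
    rw [← h] at h2
    simp [S, Octonion.orthonormal_e.norm_eq_one] at h2
  let φ : OctonionSq →ₗᵢ[ℝ] v := ⟨spinorMap ψ s, hiso⟩
  have hsurj : Function.Surjective φ := by
    intro T
    have : T ∈ N := hN ▸ Submodule.mem_top
    exact this
  let Φ := LinearIsometryEquiv.ofSurjective φ hsurj
  refine ⟨⟨ψ, Φ.symm, fun Z S => ?_⟩⟩
  obtain ⟨T, rfl⟩ := Φ.surjective S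
  rw [Φ.symm_apply_apply, LinearIsometryEquiv.symm_apply_eq]
  exact hs.cmul_spinorMap Z T

/-- A reducible orthogonal `Cl(z)`-module contains two orthogonal nonzero submodules. -/
theorem exists_orthogonal_submodules [Nontrivial v] [FiniteDimensional ℝ v]
    (horth : IsOrthogonalCliffordModule z v) (h : ¬ IsSimpleModule (Cl z) v) :
    ∃ N N' : Submodule (Cl z) v, N ≠ ⊥ ∧ N' ≠ ⊥ ∧ ∀ S ∈ N, ∀ T ∈ N', ⟪S, T⟫_ℝ = 0 := by
  obtain ⟨N, hbot, htop⟩ : ∃ N : Submodule (Cl z) v, N ≠ ⊥ ∧ N ≠ ⊤ := by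
    by_contra! hall
    refine h ((isSimpleModule_iff _ _).mpr ⟨fun N => ?_⟩)
    by_cases hN : N = ⊥
    · exact Or.inl hN
    · exact Or.inr (hall N hN)
  let W : Submodule ℝ v := (N.restrictScalars ℝ)ᗮ
  -- Skewness of Clifford multiplication makes the orthogonal complement of a submodule invariant.
  have hW : ∀ (Z : z), ∀ S ∈ W, cmul Z S ∈ W := by
    intro Z S hS
    rw [Submodule.mem_orthogonal] at hS ⊢
    intro T hT
    rw [← neg_eq_iff_eq_neg.mpr (horth Z T S), hS (cmul Z T) (N.smul_mem _ hT), neg_zero]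
  refine ⟨N, submoduleOfCmulMem W hW, hbot, fun hWbot => htop ?_,
    fun S hS T hT => Submodule.mem_orthogonal _ _ |>.mp hT S hS⟩
  have : W = ⊥ := by
    ext T
    have : T ∈ submoduleOfCmulMem W hW ↔ T ∈ (⊥ : Submodule (Cl z) v) := by rw [hWbot]
    simpa using this
  rw [Submodule.orthogonal_eq_bot_iff] at this
  ext T
  have h2 : T ∈ N.restrictScalars ℝ := this ▸ Submodule.mem_top
  simpa using h2

section HatK

variable [FiniteDimensional ℝ z] [FiniteDimensional ℝ v]

/-- The form `⟪Z₁ • Z₀ • S, Z₂ • S⟫` in the octonionic model. -/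
def octForm (c : Octonion) (S : OctonionSq) (a b : Octonion) : ℝ :=
  ⟪octCmul a (octCmul c S), octCmul b S⟫_ℝ

theorem IsOctonionicSpinor.inner_hatK_spinorMap (hs : IsOctonionicSpinor ψ s) (hs1 : ‖s‖ = 1)
    (horth : IsOrthogonalCliffordModule z v) (c : Octonion) (S : OctonionSq) (a b : Octonion) :
    ⟪hatK (ψ.symm c, spinorMap ψ s S) (ψ.symm a), ψ.symm b⟫_ℝ = octForm c S a b := by
  rw [inner_hatK]
  simp only [hs.cmul_spinorMap, hs.inner_spinorMap hs1 horth, ψ.apply_symm_apply, octForm]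

/-- `hatK` is quadratic in the spinor, and its mixed terms pair orthogonal submodules. -/
theorem IsOctonionicSpinor.inner_hatK_spinorMap_add {s' : v} (hs : IsOctonionicSpinor ψ s)
    (hs' : IsOctonionicSpinor ψ s') (hs1 : ‖s‖ = 1) (hs1' : ‖s'‖ = 1)
    (horth : IsOrthogonalCliffordModule z v)
    (hperp : ∀ S T, ⟪spinorMap ψ s S, spinorMap ψ s' T⟫_ℝ = 0)
    (c : Octonion) (S T : OctonionSq) (a b : Octonion) :
    ⟪hatK (ψ.symm c, spinorMap ψ s S + spinorMap ψ s' T) (ψ.symm a), ψ.symm b⟫_ℝ =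
      octForm c S a b + octForm c T a b := by
  have hperp' : ∀ S T, ⟪spinorMap ψ s' S, spinorMap ψ s T⟫_ℝ = 0 := fun S T => by
    rw [real_inner_comm, hperp]
  rw [inner_hatK]
  simp only [cmul_add_right, inner_add_left, inner_add_right, hs.cmul_spinorMap,
    hs'.cmul_spinorMap, hs.inner_spinorMap hs1 horth, hs'.inner_spinorMap hs1' horth,
    ψ.apply_symm_apply, octForm, hperp, hperp']
  ring

/-- `K̂` vanishes at some point of `D`. -/
theorem exists_hatK_eq_zero [Nontrivial v] (horth : IsOrthogonalCliffordModule z v)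
    (hdim : Module.finrank ℝ z = 8) : ∃ P : z × v, P.1 ≠ 0 ∧ P.2 ≠ 0 ∧ hatK P = 0 := by
  obtain ⟨ψ⟩ := nonempty_linearIsometryEquiv_octonion hdim
  obtain ⟨s, -, hs1, hs⟩ := exists_isOctonionicSpinor (v := v) ψ (N := ⊤) top_ne_bot
  -- For a half-spinor, `Z₁ • Z₀ • S` and `Z₂ • S` lie in opposite, orthogonal halves.
  let S : OctonionSq := WithLp.toLp 2 (Octonion.e 0, 0)
  have he := Octonion.orthonormal_e.norm_eq_one 0
  refine ⟨(ψ.symm (Octonion.e 0), spinorMap ψ s S), ?_, ?_, ?_⟩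
  · rw [← norm_ne_zero_iff]
    simp [he]
  · rw [← norm_ne_zero_iff]
    have h2 := WithLp.prod_norm_sq_eq_of_L2 S
    intro h
    rw [hs.norm_spinorMap hs1 horth] at h
    simp [h, S, he] at h2
  · ext Z
    obtain ⟨a, rfl⟩ := ψ.symm.surjective Z
    refine ext_inner_right ℝ fun W => ?_
    obtain ⟨b, rfl⟩ := ψ.symm.surjective W
    rw [hs.inner_hatK_spinorMap hs1 horth, LinearMap.zero_apply, inner_zero_left, octForm]
    have h0 (x : Octonion) : Octonion.mul 0 x = 0 := by
      apply Octonion.ext_coord <;> simp [Octonion.mul]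
    simp [octCmul, WithLp.prod_inner_apply, S, h0]

end HatK

end SpinorMap

/-! ### A point with four eigenvalues in the reducible case. -/

section Reducible

open Octonion

/-- The vector `w` is the value at `a` of `hatK` at the chosen point. The point keeps it sparse: `e
4` is killed, `e 0` and `e 2` are exchanged with `e 6`, and `e 1`, `e 3` with `e 5`, `e 7`. -/
theorem octForm_add_eq (a w : Octonion) (S T : OctonionSq)
    (hS : S = WithLp.toLp 2 (e 0, -e 2)) (hT : T = WithLp.toLp 2 ((2 : ℝ) • e 1, e 1))
    (hw : coord w = ![-2 * coord a 6, 4 * coord a 5 + 2 * coord a 7, -4 * coord a 6,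
      -2 * coord a 5 - 4 * coord a 7, 0, -4 * coord a 1 + 2 * coord a 3,
      2 * coord a 0 + 4 * coord a 2, -2 * coord a 1 + 4 * coord a 3]) (b : Octonion) :
    octForm (e 4) S a b + octForm (e 4) T a b = ⟪w, b⟫_ℝ := by
  rw [inner_eq w b, hw]
  simp only [octForm, octCmul, WithLp.prod_inner_apply, hS, hT]
  simp [Fin.sum_univ_eight, coord, mul, conj, e, Quaternion.inner_def]
  ring

variable {z v : Type*} [NormedAddCommGroup z] [InnerProductSpace ℝ z]
  [NormedAddCommGroup v] [InnerProductSpace ℝ v] [Module (Cl z) v] [IsScalarTower ℝ (Cl z) v]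
  [FiniteDimensional ℝ z] [FiniteDimensional ℝ v]

/-- On a reducible module, `-K̂²` has four distinct eigenvalues at some point. -/
theorem exists_four_le_card_eigenvalueFinset [Nontrivial v]
    (horth : IsOrthogonalCliffordModule z v) (hdim : Module.finrank ℝ z = 8)
    (hred : ¬ IsSimpleModule (Cl z) v) :
    ∃ X₀ : z × v, 4 ≤ (eigenvalueFinset (negHatKSq X₀)).card := by
  obtain ⟨ψ⟩ := nonempty_linearIsometryEquiv_octonion hdim
  obtain ⟨N, N', hN, hN', hperp⟩ := exists_orthogonal_submodules horth hred
  obtain ⟨s, hsN, hs1, hs⟩ := exists_isOctonionicSpinor ψ hN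
  obtain ⟨s', hsN', hs1', hs'⟩ := exists_isOctonionicSpinor ψ hN'
  let X₀ : z × v := (ψ.symm (e 4), spinorMap ψ s (WithLp.toLp 2 (e 0, -e 2)) +
    spinorMap ψ s' (WithLp.toLp 2 ((2 : ℝ) • e 1, e 1)))
  have hK (a w : Octonion) (hw : coord w = ![-2 * coord a 6, 4 * coord a 5 + 2 * coord a 7,
      -4 * coord a 6, -2 * coord a 5 - 4 * coord a 7, 0, -4 * coord a 1 + 2 * coord a 3,
      2 * coord a 0 + 4 * coord a 2, -2 * coord a 1 + 4 * coord a 3]) :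
      hatK X₀ (ψ.symm a) = ψ.symm w := by
    refine ext_inner_right ℝ fun W => ?_
    obtain ⟨b, rfl⟩ := ψ.symm.surjective W
    rw [hs.inner_hatK_spinorMap_add hs' hs1 hs1' horth (fun S T => hperp _ (spinorMap_mem ψ hsN S)
      _ (spinorMap_mem ψ hsN' T)), octForm_add_eq a w _ _ rfl rfl hw, ψ.symm.inner_map_map]
  have heig (a w : Octonion) (ν : ℝ) (ha : a ≠ 0) (h1 : hatK X₀ (ψ.symm a) = ψ.symm w)
      (h2 : hatK X₀ (ψ.symm w) = ψ.symm (-(ν • a))) :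
      ν ∈ eigenvalueFinset (negHatKSq X₀) := by
    rw [mem_eigenvalueFinset]
    refine Module.End.hasEigenvalue_of_hasEigenvector (x := ψ.symm a) ⟨?_, ?_⟩
    · rw [Module.End.mem_eigenspace_iff, negHatKSq, LinearMap.neg_apply, Module.End.mul_apply, h1,
        h2, map_neg, neg_neg, map_smul]
    · simpa using ha
  have hne {a : Octonion} (i : Fin 8) (h : coord a i ≠ 0) : a ≠ 0 := by
    rintro rfl
    apply h
    fin_cases i <;> simp [coord]
  -- Squared singular values of these blocks: 20 = 2² + 4² on `e 6`, while `e 1 + e 3` and `e 1 - e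
  -- 3` diagonalize the two-by-two block with 4 and 36.
  have hsub : ({0, 4, 20, 36} : Finset ℝ) ⊆ eigenvalueFinset (negHatKSq X₀) := by
    intro ν hν
    simp only [Finset.mem_insert, Finset.mem_singleton] at hν
    rcases hν with rfl | rfl | rfl | rfl
    · exact heig (e 4) 0 0 (hne 4 (by simp [coord, e]))
        (hK _ _ (by funext i; fin_cases i <;> simp [coord, e]))
        (hK _ _ (by funext i; fin_cases i <;> simp [coord]))
    · exact heig (e 1 + e 3) ((-2 : ℝ) • e 5 + (2 : ℝ) • e 7) 4 (hne 1 (by simp [coord, e]))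
        (hK _ _ (by funext i; fin_cases i <;> simp [coord, e] <;> norm_num))
        (hK _ _ (by funext i; fin_cases i <;> simp [coord, e] <;> norm_num))
    · exact heig (e 6) ((-2 : ℝ) • e 0 - (4 : ℝ) • e 2) 20 (hne 6 (by simp [coord, e]))
        (hK _ _ (by funext i; fin_cases i <;> simp [coord, e]))
        (hK _ _ (by funext i; (fin_cases i <;> simp [coord, e]); norm_num))
    · exact heig (e 1 - e 3) ((-6 : ℝ) • e 5 - (6 : ℝ) • e 7) 36 (hne 1 (by simp [coord, e]))
        (hK _ _ (by funext i; fin_cases i <;> simp [coord, e] <;> norm_num))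
        (hK _ _ (by funext i; fin_cases i <;> simp [coord, e] <;> norm_num))
  exact ⟨X₀, le_of_eq_of_le (by norm_num) (Finset.card_le_card hsub)⟩

end Reducible

/-! ### The spectrum in the octonionic model. -/

section Irreducible

variable {z v : Type*} [NormedAddCommGroup z] [InnerProductSpace ℝ z]
  [NormedAddCommGroup v] [InnerProductSpace ℝ v] [Module (Cl z) v] [IsScalarTower ℝ (Cl z) v]

theorem IsOrthogonalCliffordModule.inner_cmul_left (horth : IsOrthogonalCliffordModule z v)
    (Z W : z) (s : v) : ⟪cmul Z s, cmul W s⟫_ℝ = ⟪Z, W⟫_ℝ * ‖s‖ ^ 2 := by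
  have h := horth.inner_cmul_cmul (Z + W) s s
  rw [cmul_add_left, inner_add_left, inner_add_right, inner_add_right, horth.inner_cmul_cmul,
    horth.inner_cmul_cmul, real_inner_comm (cmul Z s), norm_add_sq_real,
    real_inner_self_eq_norm_sq] at h
  linarith

theorem IsOrthogonalCliffordModule.inner_cmul_cmul_self (horth : IsOrthogonalCliffordModule z v)
    (Z W : z) (s : v) : ⟪cmul Z (cmul W s), s⟫_ℝ = -(⟪Z, W⟫_ℝ * ‖s‖ ^ 2) := by
  rw [horth, horth.inner_cmul_left, real_inner_comm]

variable [FiniteDimensional ℝ z] [FiniteDimensional ℝ v]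

section Perp

variable (horth : IsOrthogonalCliffordModule z v) {A B : z} {τ : ℝ} {s : v} (hAB : ⟪B, A⟫_ℝ = 0)
  (h₁ : ∀ Z W : z, ⟪cmul Z (cmul A s), cmul W s⟫_ℝ = 0)
  (h₂ : ∀ Z W : z, ⟪cmul Z (cmul A (cmul (B + τ • A) s)), cmul W (cmul (B + τ • A) s)⟫_ℝ = 0)
include horth hAB h₁ h₂

/-- By `h₁` and `h₂` neither `s` nor `(B + τ • A) • s` contributes alone. In the two mixed terms the
parts with `τ` cancel, and the parts with `A B Z s = D s` add up. -/
theorem hatK_apply_of_perp {Z D : z} (hZA : ⟪Z, A⟫_ℝ = 0) (hZB : ⟪Z, B⟫_ℝ = 0)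
    (hD : cmul D s = cmul A (cmul B (cmul Z s))) :
    hatK (A, s + cmul (B + τ • A) s) Z = (2 * ‖s‖ ^ 2) • D := by
  refine ext_inner_right ℝ fun W => ?_
  rw [inner_hatK]
  simp only [cmul_add_right A s, cmul_add_right Z (cmul A s), cmul_add_right W s, inner_add_left,
    inner_add_right, h₁, h₂]
  have e1 : cmul W (cmul (B + τ • A) s) =
      -cmul (B + τ • A) (cmul W s) - (2 * ⟪W, B + τ • A⟫_ℝ) • s := by
    have := cmul_cmul_add W (B + τ • A) s
    rw [eq_sub_of_add_eq this]
    abel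
  have e2 : cmul (B + τ • A) (cmul Z (cmul A s)) = cmul D s + (τ * ‖A‖ ^ 2) • cmul Z s := by
    rw [cmul_cmul_comm_of_inner_eq_zero hZA, cmul_neg_right, cmul_add_left, cmul_smul_left,
      cmul_cmul, cmul_cmul_comm_of_inner_eq_zero hAB, hD]
    module
  have e3 : cmul Z (cmul A (cmul (B + τ • A) s)) = cmul D s - (τ * ‖A‖ ^ 2) • cmul Z s := by
    rw [cmul_add_left, cmul_smul_left, cmul_add_right, cmul_smul_right, cmul_cmul, cmul_add_right,
      cmul_cmul_comm_of_inner_eq_zero hZA, cmul_cmul_comm_of_inner_eq_zero hZB, cmul_neg_right, hD,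
      cmul_smul_right, cmul_neg_right, cmul_smul_right]
    module
  rw [e1, inner_sub_right, inner_neg_right, inner_smul_right, ← horth, e2, e3,
    horth.inner_cmul_cmul_self, hZA, inner_add_left, inner_sub_left, inner_smul_left,
    horth.inner_cmul_left, inner_smul_left]
  simp
  ring

/-- The vector `D` is again perpendicular to `A` and `B`, and passing from `Z` to `D` twice
multiplies by `-‖A‖² ‖B‖²`, so `hatK_apply_of_perp` applies twice. -/
theorem negHatKSq_apply_of_perp (hs : s ≠ 0) {Z D : z} (hZA : ⟪Z, A⟫_ℝ = 0) (hZB : ⟪Z, B⟫_ℝ = 0)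
    (hD : cmul D s = cmul A (cmul B (cmul Z s))) :
    negHatKSq (A, s + cmul (B + τ • A) s) Z = (4 * ‖s‖ ^ 4 * ‖A‖ ^ 2 * ‖B‖ ^ 2) • Z := by
  have hs2 : ‖s‖ ^ 2 ≠ 0 := by have := norm_ne_zero_iff.mpr hs; positivity
  have hDA : ⟪D, A⟫_ℝ = 0 := by
    have h := horth.inner_cmul_left D A s
    rw [hD, horth.inner_cmul_cmul, horth.inner_cmul_cmul_self, real_inner_comm, hZB] at h
    simpa [hs2] using h.symm
  have hDB : ⟪D, B⟫_ℝ = 0 := by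
    have h := horth.inner_cmul_left D B s
    rw [hD, ← neg_neg (cmul A _), ← cmul_cmul_comm_of_inner_eq_zero hAB, inner_neg_left,
      horth.inner_cmul_cmul, horth.inner_cmul_cmul_self, real_inner_comm, hZA] at h
    simpa [hs2] using h.symm
  have hD2 : cmul (-((‖A‖ ^ 2 * ‖B‖ ^ 2) • Z)) s = cmul A (cmul B (cmul D s)) := by
    rw [hD, cmul_cmul_comm_of_inner_eq_zero hAB, cmul_cmul, cmul_neg_right,
      cmul_neg_right, cmul_smul_right, cmul_neg_right, cmul_smul_right, cmul_cmul, cmul_neg_left, cmul_smul_left]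
    module
  rw [negHatKSq, LinearMap.neg_apply, Module.End.mul_apply,
    hatK_apply_of_perp horth hAB h₁ h₂ hZA hZB hD, map_smul,
    hatK_apply_of_perp horth hAB h₁ h₂ hDA hDB hD2]
  module

end Perp

/-- Take for `s` the first half of `X.2`. The map `Z ↦ Z • s` is injective into the other half,
which also has dimension 8. So the second half of `X.2` is `T • s`, and `B` is the part of `T`
perpendicular to `X.1`. The same surjectivity provides `D`. -/
theorem OctonionicModel.exists_of_fst_ne_zero (horth : IsOrthogonalCliffordModule z v)
    (e : OctonionicModel z v) (X : z × v) (hX : X.1 ≠ 0) (ha : (e.onSpinors X.2).fst ≠ 0) :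
    ∃ (s : v) (B : z) (τ : ℝ), s ≠ 0 ∧ ⟪B, X.1⟫_ℝ = 0 ∧ X.2 = s + cmul (B + τ • X.1) s ∧
      (∀ Z W : z, ⟪cmul Z (cmul X.1 s), cmul W s⟫_ℝ = 0) ∧
      (∀ Z W : z, ⟪cmul Z (cmul X.1 (cmul (B + τ • X.1) s)),
        cmul W (cmul (B + τ • X.1) s)⟫_ℝ = 0) ∧
      (∀ Z : z, ∃ D : z, cmul D s = cmul X.1 (cmul B (cmul Z s))) ∧
      octHatMu (e.onVectors X.1) (e.onSpinors X.2) = 4 * ‖s‖ ^ 4 * ‖X.1‖ ^ 2 * ‖B‖ ^ 2 := by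
  obtain ⟨A, x⟩ := X
  simp only at hX ha ⊢
  set a := (e.onSpinors x).fst with ha_def
  set b := (e.onSpinors x).snd with hb_def
  let P : Octonion → v := fun c => e.onSpinors.symm (WithLp.toLp 2 (c, 0))
  let M : Octonion → v := fun c => e.onSpinors.symm (WithLp.toLp 2 (0, c))
  have h0 (c : Octonion) : Octonion.mul 0 c = 0 := by
    apply Octonion.ext_coord <;> simp [Octonion.mul]
  have cP (Z : z) (c : Octonion) : cmul Z (P c) = M (-Octonion.mul c (Octonion.conj (e.onVectors Z))) := by
    apply e.onSpinors.injective
    rw [e.map_cmul]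
    simp [P, M, octCmul, h0]
  have cM (Z : z) (c : Octonion) : cmul Z (M c) = P (Octonion.mul c (e.onVectors Z)) := by
    apply e.onSpinors.injective
    rw [e.map_cmul]
    simp [P, M, octCmul, h0]
  have iPM (c d : Octonion) : ⟪P c, M d⟫_ℝ = 0 := by
    simp [P, M, LinearIsometryEquiv.inner_map_map, WithLp.prod_inner_apply]
  have iMP (c d : Octonion) : ⟪M c, P d⟫_ℝ = 0 := by rw [real_inner_comm, iPM]
  have iPP (c d : Octonion) : ⟪P c, P d⟫_ℝ = ⟪c, d⟫_ℝ := by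
    simp [P, LinearIsometryEquiv.inner_map_map, WithLp.prod_inner_apply]
  have nP (c : Octonion) : ‖P c‖ ^ 2 = ‖c‖ ^ 2 := by
    rw [← real_inner_self_eq_norm_sq, iPP, real_inner_self_eq_norm_sq]
  have nM (c : Octonion) : ‖M c‖ ^ 2 = ‖c‖ ^ 2 := by
    simp [M, WithLp.prod_norm_sq_eq_of_L2]
  have hx : x = P a + M b := by
    apply e.onSpinors.injective
    apply WithLp.ofLp_injective 2
    simp [P, M, a, b]
    rfl
  have hPa : P a ≠ 0 := by
    intro h
    have := nP a
    rw [h, norm_zero, zero_pow two_ne_zero] at this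
    exact pow_ne_zero 2 (norm_ne_zero_iff.mpr ha) this.symm
  let f : z →ₗ[ℝ] Octonion :=
    { toFun := fun Z => (e.onSpinors (cmul Z (P a))).snd
      map_add' := fun Z W => by simp [cmul_add_left]
      map_smul' := fun c Z => by simp [cmul_smul_left] }
  have hMf (Z : z) : cmul Z (P a) = M (f Z) := by
    simp [f, cP, M]
  have hinj : Function.Injective f := by
    rw [← LinearMap.ker_eq_bot, LinearMap.ker_eq_bot']
    intro Z hZ
    have h1 := hMf Z
    have h2 := horth.inner_cmul_left Z Z (P a)
    rw [h1, hZ, real_inner_self_eq_norm_sq, nM, real_inner_self_eq_norm_sq] at h2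
    simpa [hPa] using h2.symm
  have hsurj : Function.Surjective f := by
    refine (LinearMap.injective_iff_surjective_of_finrank_eq_finrank ?_).mp hinj
    exact e.onVectors.toLinearEquiv.finrank_eq
  have hex (c : Octonion) : ∃ Z : z, cmul Z (P a) = M c := by
    obtain ⟨Z, hZ⟩ := hsurj c
    exact ⟨Z, by rw [hMf, hZ]⟩
  obtain ⟨T, hT⟩ := hex b
  have hA2 : ‖A‖ ^ 2 ≠ 0 := by have := norm_ne_zero_iff.mpr hX; positivity
  set τ := ⟪T, A⟫_ℝ / ‖A‖ ^ 2 with hτ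
  have hBT : T - τ • A + τ • A = T := sub_add_cancel _ _
  have hBA : ⟪T - τ • A, A⟫_ℝ = 0 := by
    rw [inner_sub_left, real_inner_smul_left, real_inner_self_eq_norm_sq, hτ]
    field_simp
    ring
  refine ⟨P a, T - τ • A, τ, hPa, hBA, ?_, ?_, ?_, ?_, ?_⟩
  · rw [hBT, hT, hx]
  · intro Z W
    rw [cP, cM, cP, iPM]
  · intro Z W
    rw [hBT, hT, cM, cM, cP, iMP]
  · intro Z
    obtain ⟨D, hD⟩ := hex (-Octonion.mul (Octonion.mul (-Octonion.mul a (Octonion.conj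
      (e.onVectors Z))) (e.onVectors (T - τ • A))) (Octonion.conj (e.onVectors A)))
    exact ⟨D, by rw [hD, cP Z, cM, cP]⟩
  -- In `octHatMu` the squared inner product removes exactly the component `τ • A` of `T`, leaving
  -- `‖B‖²`.
  · have h1 : ⟪a, Octonion.mul b (e.onVectors A)⟫_ℝ = -(τ * ‖A‖ ^ 2 * ‖P a‖ ^ 2) := by
      rw [← iPP, ← cM, ← hT, real_inner_comm, horth.inner_cmul_cmul_self, hτ,
        div_mul_cancel₀ _ hA2, real_inner_comm]
    have h2 : ‖b‖ ^ 2 = (‖T - τ • A‖ ^ 2 + τ ^ 2 * ‖A‖ ^ 2) * ‖P a‖ ^ 2 := by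
      have h3 := horth.inner_cmul_left T T (P a)
      rw [hT, real_inner_self_eq_norm_sq, nM, ← hBT, real_inner_self_eq_norm_sq,
        norm_add_sq_real, real_inner_smul_right, hBA, norm_smul, mul_pow, Real.norm_eq_abs,
        sq_abs] at h3
      rw [h3]
      ring
    rw [octHatMu, ← ha_def, ← hb_def, e.onVectors.norm_map, h1, h2, ← nP a]
    ring

/-- The complement of the span of `X.1` and `B` lies in the eigenspace of `octHatMu` and has
dimension at least 6. If this value is nonzero, the kernel takes at least the other two dimensions,
so nothing remains. If it is zero, then `B = 0` and the whole operator vanishes. -/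
theorem OctonionicModel.negHatKSq_spectrum (horth : IsOrthogonalCliffordModule z v)
    (hdim : Module.finrank ℝ z = 8) (e : OctonionicModel z v) (X : z × v) (hX : X.1 ≠ 0) :
    (octHatMu (e.onVectors X.1) (e.onSpinors X.2) = 0 → negHatKSq X = 0) ∧
    (octHatMu (e.onVectors X.1) (e.onSpinors X.2) ≠ 0 →
      Module.finrank ℝ ((negHatKSq X).eigenspace
        (octHatMu (e.onVectors X.1) (e.onSpinors X.2))) = 6 ∧
      ∀ ν, (negHatKSq X).HasEigenvalue ν →
        ν = 0 ∨ ν = octHatMu (e.onVectors X.1) (e.onSpinors X.2)) := by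
  by_cases ha : (e.onSpinors X.2).fst = 0
  · have hK : negHatKSq X = 0 := by
      have : hatK X = 0 := by
        ext Z
        refine ext_inner_right ℝ fun W => ?_
        rw [inner_hatK, ← e.onSpinors.inner_map_map]
        simp only [e.map_cmul, octCmul]
        have h0 (c : Octonion) : Octonion.mul 0 c = 0 := by
          apply Octonion.ext_coord <;> simp [Octonion.mul]
        simp [WithLp.prod_inner_apply, ha, h0]
      rw [negHatKSq, this, mul_zero, neg_zero]
    refine ⟨fun _ => hK, fun h => absurd ?_ h⟩
    simp [octHatMu, ha]
  obtain ⟨s, B, τ, hs, hBA, hx, h₁, h₂, hD, hm⟩ := e.exists_of_fst_ne_zero horth X hX ha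
  have hXeq : X = (X.1, s + cmul (B + τ • X.1) s) := Prod.ext rfl hx
  set m := octHatMu (e.onVectors X.1) (e.onSpinors X.2)
  have hperp (Z : z) (hZA : ⟪Z, X.1⟫_ℝ = 0) (hZB : ⟪Z, B⟫_ℝ = 0) : negHatKSq X Z = m • Z := by
    obtain ⟨D, hD⟩ := hD Z
    rw [hXeq, negHatKSq_apply_of_perp horth hBA h₁ h₂ hs hZA hZB hD, ← hm]
  have hsA : ‖s‖ ^ 4 * ‖X.1‖ ^ 2 ≠ 0 := by
    have := norm_ne_zero_iff.mpr hs
    have := norm_ne_zero_iff.mpr hX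
    positivity
  have hT0 : negHatKSq X X.1 = 0 := by
    rw [negHatKSq, LinearMap.neg_apply, Module.End.mul_apply, horth.hatK_fst, map_zero, neg_zero]
  constructor
  · intro h0
    have hB : B = 0 := by
      have h3 : ‖s‖ ^ 4 * ‖X.1‖ ^ 2 * ‖B‖ ^ 2 = 0 := by linarith [hm.symm.trans h0]
      simpa using (mul_eq_zero.mp h3).resolve_left hsA
    ext Z
    have hA2 : ‖X.1‖ ^ 2 ≠ 0 := by have := norm_ne_zero_iff.mpr hX; positivity
    have hZ := hperp (Z - (⟪Z, X.1⟫_ℝ / ‖X.1‖ ^ 2) • X.1) (by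
      rw [inner_sub_left, real_inner_smul_left, real_inner_self_eq_norm_sq]
      field_simp
      ring) (by rw [hB, inner_zero_right])
    rw [h0, zero_smul, map_sub, map_smul, hT0, smul_zero, sub_zero] at hZ
    exact hZ
  · intro hne
    have hskew := horth.inner_hatK_left X
    have hV : Even (Module.finrank ℝ z) := by rw [hdim]; decide
    have hKX := horth.hatK_fst X
    have h0 : (negHatKSq X).HasEigenvalue 0 := hasEigenvalue_zero_neg_mul_self hskew hX hKX
    have h2 {ν : ℝ} (hν : (negHatKSq X).HasEigenvalue ν) :
        2 ≤ Module.finrank ℝ ((negHatKSq X).eigenspace ν) :=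
      two_le_finrank_eigenspace_neg_mul_self hskew hV hX hKX hν
    have h6 : 6 ≤ Module.finrank ℝ ((negHatKSq X).eigenspace m) := by
      let W := Submodule.span ℝ (Set.range ![X.1, B])
      have hW : Module.finrank ℝ W ≤ 2 := by
        exact (finrank_range_le_card (R := ℝ) ![X.1, B]).trans_eq (Fintype.card_fin 2)
      have hW2 := Submodule.finrank_add_finrank_orthogonal W
      have hle : Wᗮ ≤ (negHatKSq X).eigenspace m := by
        intro Z hZ
        rw [Submodule.mem_orthogonal'] at hZ
        rw [Module.End.mem_eigenspace_iff]
        exact hperp Z (hZ _ (Submodule.subset_span ⟨0, rfl⟩))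
          (hZ _ (Submodule.subset_span ⟨1, rfl⟩))
      have := Submodule.finrank_mono hle
      omega
    have hm' : (negHatKSq X).HasEigenvalue m := by
      rw [Module.End.hasEigenvalue_iff]
      intro hbot
      rw [hbot, finrank_bot] at h6
      omega
    have hsum := sum_finrank_eigenspace (horth.isSymmetric_negHatKSq X)
    rw [hdim] at hsum
    have hsub (t : Finset ℝ) (ht : t ⊆ eigenvalueFinset (negHatKSq X)) :
        ∑ ν ∈ t, Module.finrank ℝ ((negHatKSq X).eigenspace ν) ≤ 8 :=
      hsum ▸ Finset.sum_le_sum_of_subset ht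
    constructor
    · have h := hsub {0, m} (by
        intro ν hν
        rw [Finset.mem_insert, Finset.mem_singleton] at hν
        rw [mem_eigenvalueFinset]
        rcases hν with rfl | rfl <;> assumption)
      rw [Finset.sum_pair (Ne.symm hne)] at h
      have := h2 h0
      omega
    · intro ν hν
      by_contra! hcon
      have h := hsub {0, m, ν} (by
        intro ν' hν'
        simp only [Finset.mem_insert, Finset.mem_singleton] at hν'
        rw [mem_eigenvalueFinset]
        rcases hν' with rfl | rfl | rfl <;> assumption)
      rw [Finset.sum_insert (by simp [Ne.symm hne, Ne.symm hcon.1]),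
        Finset.sum_pair (Ne.symm hcon.2)] at h
      have := h2 h0
      have := h2 hν
      omega

end Irreducible

/-! ### Counting branches in the two cases. -/

section Main

variable {z v : Type*} [NormedAddCommGroup z] [InnerProductSpace ℝ z]
  [NormedAddCommGroup v] [InnerProductSpace ℝ v] [Module (Cl z) v] [IsScalarTower ℝ (Cl z) v]
  [FiniteDimensional ℝ z] [FiniteDimensional ℝ v]

theorem IsOrthogonalCliffordModule.hasEigenvalue_zero_negCheckKSq
    (horth : IsOrthogonalCliffordModule z v) {X : z × v} (h1 : X.1 ≠ 0) (h2 : X.2 ≠ 0) :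
    (negCheckKSq X).HasEigenvalue 0 := by
  rw [hasEigenvalue_negCheckKSq_iff h1 h2, mul_zero]
  exact hasEigenvalue_zero_neg_mul_self (horth.inner_hatK_left X) h1 (horth.hatK_fst X)

theorem not_isGlobalEigenvalue_one [Nontrivial v] (horth : IsOrthogonalCliffordModule z v)
    (hdim : Module.finrank ℝ z = 8) : ¬ IsGlobalEigenvalue z v 1 := by
  intro h
  obtain ⟨P, hP1, hP2, hP⟩ := exists_hatK_eq_zero horth hdim
  obtain ⟨x, hx, hx0⟩ := (h P).exists_hasEigenvector
  rw [Module.End.mem_eigenspace_iff, negHatKSq, hP, mul_zero, neg_zero, LinearMap.zero_apply,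
    one_mul] at hx
  exact smul_ne_zero (norm_sq_mul_norm_pow_ne_zero hP1 hP2) hx0 hx.symm

/-- The eigenvalue branches of an irreducible module. -/
theorem exists_nonconstantBranches_eq_singleton [Nontrivial v]
    (horth : IsOrthogonalCliffordModule z v) (hdim : Module.finrank ℝ z = 8)
    (e₀ : OctonionicModel z v) {U : Set (z × v)} (hU : IsUnramifiedComponent z v U) :
    ∃ μ : U → ℝ, nonconstantBranches U = {μ} ∧
      (∀ X : U, eigMult (X : z × v) (μ X) = 6) ∧
      ∀ (e : OctonionicModel z v) (X : U),
        ‖(X : z × v).1‖ ^ 2 * ‖(X : z × v).2‖ ^ 4 * μ X =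
          octHatMu (e.onVectors (X : z × v).1) (e.onSpinors (X : z × v).2) := by
  obtain ⟨P, hP1, hP2, hP⟩ := exists_hatK_eq_zero horth hdim
  have hsub (e : OctonionicModel z v) (X : z × v) (hX : X.1 ≠ 0) : eigenvalueFinset (negHatKSq X) ⊆
      {0, octHatMu (e.onVectors X.1) (e.onSpinors X.2)} := by
    intro ν hν
    rw [mem_eigenvalueFinset] at hν
    rw [Finset.mem_insert, Finset.mem_singleton]
    have hs := e.negHatKSq_spectrum horth hdim X hX
    by_cases hm : octHatMu (e.onVectors X.1) (e.onSpinors X.2) = 0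
    · left
      obtain ⟨x, hx, hx0⟩ := hν.exists_hasEigenvector
      rw [Module.End.mem_eigenspace_iff, hs.1 hm, LinearMap.zero_apply] at hx
      exact (smul_eq_zero.mp hx.symm).resolve_right hx0
    · exact (hs.2 hm).2 ν hν
  have hle : ∀ X : z × v, X.1 ≠ 0 → X.2 ≠ 0 → numEigenvalues X ≤ 2 := by
    intro X h1 h2
    rw [numEigenvalues_eq_card_negHatKSq h1 h2]
    exact (Finset.card_le_card (hsub e₀ X h1)).trans Finset.card_le_two
  -- Three unit octonions with `e 0` perpendicular to `e 1 * e 0`, so `octHatMu` takes the value 4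
  -- and two eigenvalues occur.
  let X₀ : z × v := (e₀.onVectors.symm (Octonion.e 0),
    e₀.onSpinors.symm (WithLp.toLp 2 (Octonion.e 0, Octonion.e 1)))
  have hX₀ : 2 ≤ (eigenvalueFinset (negHatKSq X₀)).card := by
    have he := Octonion.orthonormal_e.norm_eq_one
    have hX1 : X₀.1 ≠ 0 := by
      rw [← norm_ne_zero_iff]; simp [X₀, he]
    have hm : octHatMu (e₀.onVectors X₀.1) (e₀.onSpinors X₀.2) = 4 := by
      simp only [X₀, LinearIsometryEquiv.apply_symm_apply, octHatMu, he, WithLp.toLp_fst,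
        WithLp.toLp_snd]
      rw [Octonion.inner_eq]
      simp [Octonion.coord, Octonion.mul, Octonion.e, Fin.sum_univ_eight]
    have hs := (e₀.negHatKSq_spectrum horth hdim X₀ hX1).2 (by rw [hm]; norm_num)
    rw [hm] at hs
    have h4 : (negHatKSq X₀).HasEigenvalue 4 := by
      rw [Module.End.hasEigenvalue_iff]
      intro hbot
      rw [hbot, finrank_bot] at hs
      omega
    have h0 : (negHatKSq X₀).HasEigenvalue 0 :=
      hasEigenvalue_zero_neg_mul_self (horth.inner_hatK_left X₀) hX1 (horth.hatK_fst X₀)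
    refine le_of_eq_of_le (b := (({0, 4} : Finset ℝ)).card) (by norm_num)
      (Finset.card_le_card fun ν hν => ?_)
    rw [Finset.mem_insert, Finset.mem_singleton] at hν
    rw [mem_eigenvalueFinset]
    rcases hν with rfl | rfl <;> assumption
  obtain ⟨hUD, hcard, hbr⟩ := nonconstantBranches_of_isUnramifiedComponent horth hle hX₀
    (fun X h1 h2 => horth.hasEigenvalue_zero_negCheckKSq h1 h2) hP1 hP2 hP hU
  obtain ⟨μ, hμ⟩ := Set.ncard_eq_one.mp hcard
  have hval (e : OctonionicModel z v) (X : U) :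
      ‖(X : z × v).1‖ ^ 2 * ‖(X : z × v).2‖ ^ 4 * μ X =
        octHatMu (e.onVectors (X : z × v).1) (e.onSpinors (X : z × v).2) ∧
      ‖(X : z × v).1‖ ^ 2 * ‖(X : z × v).2‖ ^ 4 * μ X ≠ 0 := by
    obtain ⟨h1, h2, -⟩ := hUD X X.2
    -- The nonconstant branch never meets the zero branch, so among the two possible eigenvalues it
    -- must be the value of `octHatMu`, whichever model `e` is used.
    obtain ⟨hne, heig⟩ := hbr μ (hμ ▸ rfl) X
    have hne' := mul_ne_zero (norm_sq_mul_norm_pow_ne_zero h1 h2) hne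
    rw [hasEigenvalue_negCheckKSq_iff h1 h2, ← mem_eigenvalueFinset] at heig
    have := hsub e X h1 heig
    rw [Finset.mem_insert, Finset.mem_singleton] at this
    exact ⟨this.resolve_left hne', hne'⟩
  refine ⟨μ, hμ, fun X => ?_, fun e X => (hval e X).1⟩
  obtain ⟨h1, h2, -⟩ := hUD X X.2
  obtain ⟨heq, hne⟩ := hval e₀ X
  rw [eigMult, eigenspace_negCheckKSq h1 h2, heq]
  exact ((e₀.negHatKSq_spectrum horth hdim X h1).2 (heq ▸ hne)).1

/-- The eigenvalue branches of a reducible module. -/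
theorem ncard_nonconstantBranches_eq_three [Nontrivial v]
    (horth : IsOrthogonalCliffordModule z v) (hdim : Module.finrank ℝ z = 8)
    (hred : ¬ IsSimpleModule (Cl z) v) {U : Set (z × v)} (hU : IsUnramifiedComponent z v U) :
    (nonconstantBranches U).ncard = 3 ∧
      ∀ μ ∈ nonconstantBranches U, ∀ X : U, eigMult (X : z × v) (μ X) = 2 := by
  obtain ⟨P, hP1, hP2, hP⟩ := exists_hatK_eq_zero horth hdim
  obtain ⟨X₀, hX₀⟩ := exists_four_le_card_eigenvalueFinset horth hdim hred
  have hV : Even (Module.finrank ℝ z) := by rw [hdim]; decide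
  have hle : ∀ X : z × v, X.1 ≠ 0 → X.2 ≠ 0 → numEigenvalues X ≤ 4 := by
    intro X h1 h2
    rw [numEigenvalues_eq_card_negHatKSq h1 h2]
    have := two_mul_card_eigenvalueFinset_le (horth.inner_hatK_left X) hV h1 (horth.hatK_fst X)
    rw [hdim] at this
    have h' : 2 * (eigenvalueFinset (negHatKSq X)).card ≤ 8 := this
    omega
  obtain ⟨hUD, hcard, hbr⟩ := nonconstantBranches_of_isUnramifiedComponent horth hle hX₀
    (fun X h1 h2 => horth.hasEigenvalue_zero_negCheckKSq h1 h2) hP1 hP2 hP hU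
  refine ⟨hcard, fun μ hμ X => ?_⟩
  obtain ⟨h1, h2, hnum⟩ := hUD X X.2
  have heig := (hbr μ hμ X).2
  rw [numEigenvalues_eq_card_negHatKSq h1 h2] at hnum
  rw [hasEigenvalue_negCheckKSq_iff h1 h2] at heig
  rw [eigMult, eigenspace_negCheckKSq h1 h2]
  -- Four eigenspaces of dimension at least 2 fill the eight dimensions, so each has dimension
  -- exactly 2.
  refine finrank_eigenspace_eq_two (horth.inner_hatK_left X) hV h1 (horth.hatK_fst X) ?_ heig
  change 2 * (eigenvalueFinset (negHatKSq (X : z × v))).card = _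
  rw [hnum, hdim]

end Main

end

theorem proposition5p4 {z v : Type*}
    [NormedAddCommGroup z] [InnerProductSpace ℝ z] [FiniteDimensional ℝ z]
    [NormedAddCommGroup v] [InnerProductSpace ℝ v] [FiniteDimensional ℝ v] [Nontrivial v]
    [Module (Cl z) v] [IsScalarTower ℝ (Cl z) v]
    (horth : IsOrthogonalCliffordModule z v) (hdim : Module.finrank ℝ z = 8) :
    (IsSimpleModule (Cl z) v →
      Nonempty (OctonionicModel z v) ∧
      (∀ U : Set (z × v), IsUnramifiedComponent z v U →
        ∃ μ : U → ℝ, nonconstantBranches U = {μ} ∧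
          (∀ X : U, eigMult (X : z × v) (μ X) = 6) ∧
          ∀ (e : OctonionicModel z v) (X : U),
            ‖(X : z × v).1‖ ^ 2 * ‖(X : z × v).2‖ ^ 4 * μ X =
              octHatMu (e.onVectors (X : z × v).1) (e.onSpinors (X : z × v).2))) ∧
    (¬ IsSimpleModule (Cl z) v →
      ∀ U : Set (z × v), IsUnramifiedComponent z v U →
        (nonconstantBranches U).ncard = 3 ∧
        ∀ μ ∈ nonconstantBranches U, ∀ X : U, eigMult (X : z × v) (μ X) = 2) ∧
    ¬ IsGlobalEigenvalue z v 1 := by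
  refine ⟨fun hs => ?_, fun hred U hU => ncard_nonconstantBranches_eq_three horth hdim hred hU,
    not_isGlobalEigenvalue_one horth hdim⟩
  have hne := nonempty_octonionicModel horth hdim hs
  obtain ⟨e⟩ := hne
  exact ⟨⟨e⟩, fun U hU => exists_nonconstantBranches_eq_singleton horth hdim e hU⟩
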